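/- Let $G=(V,E)$ be a finite multigraph; its vertices are the agents and its edges are the goods. Each agent $i\in V$ has a valuation $v_i:2^E\to\mathbb{R}$ that is normalized ($v_i(\emptyset)=0$), monotone ($v_i(S)\le v_i(T)$ whenever $S\subseteq T\subseteq E$), and for which edges not adjacent to $i$ are irrelevant: $v_i(S\cup\{g\})=v_i(S)$ for every $S\subseteq E$ and every $g\in E$ that does not have $i$ as an endpoint. Two edges are called parallel if they have the same endpoints. Suppose that the shortest cycle of $G$ using no two parallel edges has length at least $6$, i.e. every cycle of $G$ whose edges are pairwise non-parallel has length at least $6$ (a loop counts as such a cycle of length $1$, so $G$ has no loops; multigraphs without any such cycle are included). Then there exists a complete EFX allocation: a family $(X_i)_{i\in V}$ of pairwise disjoint, possibly empty, sets of edges with $\bigcup_{i\in V}X_i=E$ such that $$v_i(X_i)\ \ge\ v_i(X_j\setminus\{g\})\qquad\text{for all } i,j\in V \text{ and all } g\in X_j .$$ -/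

import Mathlib

open scoped Graph

namespace MultigraphEFX

variable {V E : Type*}

/-- Two edges of a multigraph are parallel if they have the same endpoints. -/
def Parallel (G : Graph V E) (e f : E) : Prop :=
  ∃ x y, G.IsLink e x y ∧ G.IsLink f x y

/-- The vertices `x 0, …, x (k - 1)` and the edges `e 0, …, e (k - 1)` form a cycle of length `k`
in `G` that uses no two parallel edges: the vertices are pairwise distinct, `e t` joins `x t` and
`x (t + 1)`, the last edge returns to `x k = x 0`, and no two of the edges are parallel.
(A loop is such a cycle of length one; two parallel edges do not form such a cycle.) -/
structure IsNonparallelCycle (G : Graph V E) (k : ℕ) (x : ℕ → V) (e : ℕ → E) : Prop where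
  pos : 0 < k
  closed : x k = x 0
  vertex_inj : ∀ s t, s < k → t < k → x s = x t → s = t
  link : ∀ t, t < k → G.IsLink (e t) (x t) (x (t + 1))
  nonparallel : ∀ s t, s < k → t < k → s ≠ t → ¬ Parallel G (e s) (e t)

/-- The valuations allowed for the vertex `i` in the multigraph setting: a set function on the
subsets of the edge set that is normalized, monotone, and to which the edges that are not adjacent
to `i` are irrelevant. -/
structure IsValuation (G : Graph V E) (i : V) (v : Set E → ℝ) : Prop where
  empty : v ∅ = 0
  mono : ∀ S T, S ⊆ T → T ⊆ E(G) → v S ≤ v T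
  irrelevant : ∀ S g, S ⊆ E(G) → g ∈ E(G) → ¬ G.Inc g i → v (S ∪ {g}) = v S

/-- An allocation gives to the vertices of `G` pairwise disjoint (possibly empty) sets of edges. -/
structure IsAllocation (G : Graph V E) (X : V → Set E) : Prop where
  subset : ∀ i ∈ V(G), X i ⊆ E(G)
  disjoint : ∀ i ∈ V(G), ∀ j ∈ V(G), i ≠ j → Disjoint (X i) (X j)

/-- An allocation is complete if every edge of `G` is given to some vertex of `G`. -/
structure IsCompleteAllocation (G : Graph V E) (X : V → Set E) : Prop
    extends IsAllocation G X where
  complete : ∀ e ∈ E(G), ∃ i ∈ V(G), e ∈ X i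

/-- Envy-freeness up to any good: whichever good `g` is removed from the set of a vertex `j`,
no vertex `i` values the rest more than its own set. The removed good may be irrelevant to `i`. -/
def IsEFX (G : Graph V E) (v : V → Set E → ℝ) (X : V → Set E) : Prop :=
  ∀ i ∈ V(G), ∀ j ∈ V(G), ∀ g ∈ X j, v i (X j \ {g}) ≤ v i (X i)

end MultigraphEFX

/-! Fix an independent set `F` of vertices. A state is a partial EFX allocation of goods to their
own ends in which nobody envies a vertex of `F`, not even after that vertex swaps its part of a
bundle of parallel goods for the rest of the bundle. States exist (`exists_isState`): each vertex of
`F` cuts every bundle at it into two parts, either of which it can bear to lose, and each other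
vertex picks its favourite part overall. Choose a Pareto optimal state. There no agent prefers the
unallocated goods at it to what it holds (`IsOptimal.val_rest_le`), since otherwise an exchange
would lead to a better state.

It remains to place the leftovers. An agent sees only the goods at it; if what it sees of an
unenvied bundle enlarged by leftovers is only the old bundle, or only leftovers, it does not envy
the result. If the underlying simple graph has a cycle, it contains a path `x 0, …, x 4`. As there
are no cycles of length 3, 4 or 5, the set `F = {x 0, x 2, x 4}` is independent, and every edge
misses some vertex of `F`, in the sense that neither end is adjacent to it (`exists_not_adj`). The
leftover goes there (`IsOptimal.hasEFX_of_dump`).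

If there is no cycle, the graph is bipartite and `F` is a colour class. Leftovers at a vertex `k`
outside `F` go to `k`, unless some vertex of `F` envies `k`; then they go to such a vertex
(`IsOptimal.hasEFX_of_bipartite`), and a further exchange argument, `IsOptimal.val_le_of_envy`,
shows that `k` does not mind. -/

namespace MultigraphEFX

/-! ### Cutting a set of goods between two agents. -/

section Cut

variable {E : Type*} [Finite E]

/-- A partition of `D` into two parts, neither of which is strictly preferred to the other after
the removal of any good, and the worse of which is at least as good as the worse of `S` and `D \ S`. -/
theorem exists_efx_cut (h : Set E → ℝ) (hmono : ∀ S T, S ⊆ T → h S ≤ h T) (D S : Set E)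
    (hS : S ⊆ D) :
    ∃ A, A ⊆ D ∧ (∀ g ∈ D \ A, h ((D \ A) \ {g}) ≤ h A) ∧ h A ≤ h (D \ A) ∧
      min (h S) (h (D \ S)) ≤ h A := by
  have hfin : (Set.univ : Set (Set E)).Finite := Set.finite_univ
  obtain ⟨A₁, hA₁, hmax₁⟩ := Set.exists_max_image {A : Set E | A ⊆ D}
    (fun A => min (h A) (h (D \ A))) (hfin.subset (Set.subset_univ _)) ⟨S, hS⟩
  -- Among the cuts with the best possible minimum, take one whose poorer part `A` has the most
  -- goods. If `g` violated the claim, moving it to `A` would either raise the minimum or enlarge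
  -- the poorer part.
  obtain ⟨A, ⟨hAD, hA⟩, hmax⟩ := Set.exists_max_image
    {A : Set E | A ⊆ D ∧ min (h A₁) (h (D \ A₁)) ≤ h A ∧ h A ≤ h (D \ A)}
    (fun A => A.ncard) (hfin.subset (Set.subset_univ _)) (by
      rcases le_total (h A₁) (h (D \ A₁)) with hle | hle
      · exact ⟨A₁, hA₁, min_le_left _ _, hle⟩
      · refine ⟨D \ A₁, Set.sdiff_subset, min_le_right _ _, ?_⟩
        rwa [Set.sdiff_sdiff_cancel_left hA₁])
  refine ⟨A, hAD, fun g hg => ?_, hA.2, (hmax₁ S hS).trans hA.1⟩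
  by_contra! hlt
  have hsub : insert g A ⊆ D := Set.insert_subset hg.1 hAD
  have heq : (D \ A) \ {g} = D \ insert g A := by
    ext x; simp only [Set.mem_sdiff, Set.mem_singleton_iff, Set.mem_insert_iff]; tauto
  rw [heq] at hlt
  have hm := hmax₁ _ hsub
  have hA' : h A ≤ h (insert g A) := hmono _ _ (Set.subset_insert _ _)
  have hle : h (insert g A) ≤ h A := by
    by_contra! hcon
    have := lt_min hcon hlt
    linarith [hA.1]
  have hcard := hmax (insert g A) ⟨hsub, hA.1.trans hA', hle.trans hlt.le⟩
  have := Set.ncard_insert_of_notMem hg.2 (Set.toFinite A)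
  omega

/-- Two agents with valuations `f`, `h` and thresholds `x`, `y` of whom at least one wants the set
`D`: either `D` can be shared so that both exceed their thresholds, or one of them takes a part that
the other one tolerates, and tolerates the complement as well. -/
theorem exists_improving_cut (f h : Set E → ℝ) (hf : ∀ S T, S ⊆ T → f S ≤ f T)
    (hh : ∀ S T, S ⊆ T → h S ≤ h T) (D : Set E) (x y : ℝ) (hD : x < f D ∨ y < h D) :
    ∃ A, A ⊆ D ∧
      ((x < f A ∧ y < h (D \ A) ∧ (∀ g ∈ D \ A, f ((D \ A) \ {g}) ≤ f A) ∧
          ∀ g ∈ A, h (A \ {g}) ≤ h (D \ A)) ∨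
        (x < f A ∧ h (D \ A) ≤ y ∧ ∀ g ∈ A, h (A \ {g}) ≤ y) ∨
        (y < h A ∧ f (D \ A) ≤ x ∧ ∀ g ∈ A, f (A \ {g}) ≤ x)) := by
  -- If both parts can be worth more than `y`, the agent with valuation `h` cuts and the other
  -- chooses. A chooser whose better part does not exceed `x` tolerates both parts.
  by_cases h1 : ∃ S ⊆ D, y < h S ∧ y < h (D \ S)
  · obtain ⟨S, hSD, hS1, hS2⟩ := h1
    obtain ⟨A, hAD, hA1, hA2, hA3⟩ := exists_efx_cut h hh D S hSD
    have hyA : y < h A := (lt_min hS1 hS2).trans_le hA3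
    have hA4 : ∀ g ∈ A, h (A \ {g}) ≤ h (D \ A) := fun g _ => (hh _ _ Set.sdiff_subset).trans hA2
    have hDA : D \ (D \ A) = A := Set.sdiff_sdiff_cancel_left hAD
    rcases le_total (f (D \ A)) (f A) with hle | hle
    · by_cases hx : x < f A
      · exact ⟨A, hAD, Or.inl ⟨hx, hyA.trans_le hA2, fun g _ => (hf _ _ Set.sdiff_subset).trans hle,
          hA4⟩⟩
      · push Not at hx
        exact ⟨A, hAD, Or.inr (Or.inr ⟨hyA, hle.trans hx,
          fun g _ => (hf _ _ Set.sdiff_subset).trans hx⟩)⟩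
    · by_cases hx : x < f (D \ A)
      · refine ⟨D \ A, Set.sdiff_subset, Or.inl ⟨hx, by rwa [hDA], fun g _ => ?_, fun g hg => ?_⟩⟩
        · rw [hDA]; exact (hf _ _ Set.sdiff_subset).trans hle
        · rw [hDA]; exact hA1 g hg
      · push Not at hx
        exact ⟨A, hAD, Or.inr (Or.inr ⟨hyA, hx,
          fun g _ => (hf _ _ Set.sdiff_subset).trans (hle.trans hx)⟩)⟩
  by_cases h2 : ∃ S ⊆ D, x < f S ∧ x < f (D \ S)
  · obtain ⟨S, hSD, hS1, hS2⟩ := h2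
    obtain ⟨A, hAD, hA1, hA2, hA3⟩ := exists_efx_cut f hf D S hSD
    have hyA : x < f A := (lt_min hS1 hS2).trans_le hA3
    have hDA : D \ (D \ A) = A := Set.sdiff_sdiff_cancel_left hAD
    rcases le_total (h (D \ A)) (h A) with hle | hle
    · by_cases hx : y < h A
      · refine ⟨D \ A, Set.sdiff_subset, Or.inl ⟨hyA.trans_le hA2, by rwa [hDA], fun g hg => ?_,
          fun g hg => ?_⟩⟩
        · rw [hDA]; exact (hf _ _ Set.sdiff_subset).trans hA2
        · rw [hDA]; exact (hh _ _ Set.sdiff_subset).trans hle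
      · push Not at hx
        exact ⟨A, hAD, Or.inr (Or.inl ⟨hyA, hle.trans hx,
          fun g _ => (hh _ _ Set.sdiff_subset).trans hx⟩)⟩
    · by_cases hx : y < h (D \ A)
      · exact ⟨A, hAD, Or.inl ⟨hyA, hx, hA1, fun g _ => (hh _ _ Set.sdiff_subset).trans hle⟩⟩
      · push Not at hx
        exact ⟨A, hAD, Or.inr (Or.inl ⟨hyA, hx,
          fun g _ => (hh _ _ Set.sdiff_subset).trans (hle.trans hx)⟩)⟩
  -- Now, for either agent, the complement of a part above the threshold is not above it. A smallest
  -- part `W` wanted by someone is tolerated by both after the loss of any good.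
  push Not at h1 h2
  obtain ⟨W, ⟨hWD, hW⟩, hmin⟩ := Set.exists_min_image {W : Set E | W ⊆ D ∧ (x < f W ∨ y < h W)}
    (fun W => W.ncard) (Set.toFinite _) ⟨D, subset_rfl, hD⟩
  have hW' : ∀ g ∈ W, f (W \ {g}) ≤ x ∧ h (W \ {g}) ≤ y := by
    intro g hg
    by_contra hcon
    have := hmin (W \ {g}) ⟨Set.sdiff_subset.trans hWD, by
      rw [not_and_or, not_le, not_le] at hcon; exact hcon⟩
    have := Set.ncard_sdiff_singleton_lt_of_mem hg (Set.toFinite W)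
    omega
  have hDW : D \ (D \ W) = W := Set.sdiff_sdiff_cancel_left hWD
  rcases hW with hW | hW
  · have hfx := h2 W hWD hW
    by_cases hy : y < h (D \ W)
    · exact ⟨W, hWD, Or.inl ⟨hW, hy, fun g _ => (hf _ _ Set.sdiff_subset).trans (hfx.trans hW.le),
        fun g hg => (hW' g hg).2.trans hy.le⟩⟩
    · exact ⟨W, hWD, Or.inr (Or.inl ⟨hW, not_lt.1 hy, fun g hg => (hW' g hg).2⟩)⟩
  · have hfx := h1 W hWD hW
    by_cases hy : x < f (D \ W)
    · refine ⟨D \ W, Set.sdiff_subset, Or.inl ⟨hy, by rwa [hDW], fun g hg => ?_, fun g hg => ?_⟩⟩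
      · rw [hDW] at hg ⊢; exact (hW' g hg).1.trans hy.le
      · rw [hDW]; exact (hh _ _ Set.sdiff_subset).trans (hfx.trans hW.le)
    · exact ⟨W, hWD, Or.inr (Or.inr ⟨hW, not_lt.1 hy, fun g hg => (hW' g hg).1⟩)⟩

end Cut

/-! ### Markets on a loopless multigraph. -/

/-- Agents `I` who are the vertices, and goods `E` which are the edges, of a loopless multigraph;
only the goods at a vertex matter to it. -/
structure Market (I E : Type*) where
  src : E → I
  tgt : E → I
  src_ne_tgt : ∀ e, src e ≠ tgt e
  val : I → Set E → ℝ
  val_empty : ∀ i, val i ∅ = 0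
  val_le_of_inc : ∀ i S T, (∀ e ∈ S, src e = i ∨ tgt e = i → e ∈ T) → val i S ≤ val i T

namespace Market

variable {I E : Type*} (P : Market I E)

/-- The goods at the vertex `i`. -/
def inc (i : I) : Set E := {e | P.src e = i ∨ P.tgt e = i}

/-- The goods between the vertices `i` and `j`. -/
def btw (i j : I) : Set E := {e | P.src e = i ∧ P.tgt e = j ∨ P.src e = j ∧ P.tgt e = i}

variable {P}

@[grind =] theorem mem_inc {i : I} {e : E} : e ∈ P.inc i ↔ P.src e = i ∨ P.tgt e = i := Iff.rfl

@[grind =] theorem mem_btw {i j : I} {e : E} :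
    e ∈ P.btw i j ↔ P.src e = i ∧ P.tgt e = j ∨ P.src e = j ∧ P.tgt e = i := Iff.rfl

theorem btw_comm (i j : I) : P.btw i j = P.btw j i := by
  ext e; grind

theorem val_le {i : I} {S T : Set E} (h : ∀ e ∈ S, e ∈ P.inc i → e ∈ T) : P.val i S ≤ P.val i T :=
  P.val_le_of_inc i S T h

theorem val_mono {i : I} {S T : Set E} (h : S ⊆ T) : P.val i S ≤ P.val i T :=
  val_le fun _ he _ => h he

theorem val_nonneg (i : I) (S : Set E) : 0 ≤ P.val i S := by
  rw [← P.val_empty i]; exact val_mono (Set.empty_subset S)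

theorem val_le_of_not_inc {i : I} {S : Set E} (T : Set E) (h : ∀ e ∈ S, e ∉ P.inc i) :
    P.val i S ≤ P.val i T :=
  val_le fun e he hi => absurd hi (h e he)

/-! ### States and optimal states. -/

variable (P) in
/-- The partial allocations among which an optimal one is chosen. The vertices in `F` are envied by
nobody, and remain so whichever of their goods they exchange with the unallocated ones. -/
structure IsState (F : Set I) (X : I → Set E) : Prop where
  inc : ∀ i, ∀ e ∈ X i, e ∈ P.inc i
  disj : ∀ i j e, e ∈ X i → e ∈ X j → i = j
  efx : ∀ i k, ∀ g ∈ X k, P.val i (X k \ {g}) ≤ P.val i (X i)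
  -- By `hold`, the neighbour `i` would tolerate that `k` swaps its part of the pair for the other
  -- goods. By `both` and `full`, a pair with an unallocated good is held from at most one end, and
  -- not by the neighbour of a vertex in `F`.
  hold : ∀ i k, ∀ e ∈ X k, e ∈ P.btw i k → P.val i (P.btw i k \ X k) ≤ P.val i (X i)
  both : ∀ i k, ∀ e ∈ X i, e ∈ P.btw i k → ∀ f ∈ X k, f ∈ P.btw i k → P.btw i k ⊆ X i ∪ X k
  free : ∀ z ∈ F, ∀ k, P.val k (X z) ≤ P.val k (X k)
  free_compl : ∀ z ∈ F, ∀ k, P.val k (P.btw k z \ X z) ≤ P.val k (X k)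
  full : ∀ z ∈ F, ∀ k, ∀ e ∈ X k, e ∈ P.btw k z → P.btw k z ⊆ X k ∪ X z

variable {F : Set I} {X Y : I → Set E}

/-- To check that an allocation which is at least as good for everybody is still a state, only the
bundles that have changed need to be looked at. -/
theorem IsState.of_changes (h : P.IsState F X) (hle : ∀ i, P.val i (X i) ≤ P.val i (Y i))
    (hinc : ∀ i, ∀ e ∈ Y i, e ∈ P.inc i) (hdisj : ∀ i j e, e ∈ Y i → e ∈ Y j → i = j)
    (hefx : ∀ k, Y k ≠ X k → ∀ i, i ≠ k → ∀ g ∈ Y k, P.val i (Y k \ {g}) ≤ P.val i (Y i))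
    (hhold : ∀ k, Y k ≠ X k → ∀ i, i ≠ k → ∀ e ∈ Y k, e ∈ P.btw i k →
      P.val i (P.btw i k \ Y k) ≤ P.val i (Y i))
    (hboth : ∀ k, Y k ≠ X k → ∀ i, i ≠ k → ∀ e ∈ Y i, e ∈ P.btw i k → ∀ f ∈ Y k, f ∈ P.btw i k →
      P.btw i k ⊆ Y i ∪ Y k)
    (hfree : ∀ k, Y k ≠ X k → k ∈ F → ∀ i, i ≠ k → P.val i (Y k) ≤ P.val i (Y i) ∧
      P.val i (P.btw i k \ Y k) ≤ P.val i (Y i) ∧ ∀ e ∈ Y i, e ∈ P.btw i k →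
        P.btw i k ⊆ Y i ∪ Y k)
    (hfull : ∀ k, Y k ≠ X k → ∀ z ∈ F, z ≠ k → ∀ e ∈ Y k, e ∈ P.btw k z →
      P.btw k z ⊆ Y k ∪ Y z) : P.IsState F Y := by
  have hself : ∀ i, ∀ e, e ∉ P.btw i i := fun i e he => by
    have := P.src_ne_tgt e; grind
  refine ⟨hinc, hdisj, fun i k g hg => ?_, fun i k e he hb => ?_, fun i k e he hb f hf hb' => ?_,
    fun z hz k => ?_, fun z hz k => ?_, fun z hz k e he hb => ?_⟩
  · by_cases hik : i = k
    · subst hik; exact val_mono Set.sdiff_subset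
    by_cases hk : Y k = X k
    · rw [hk] at hg ⊢; exact (h.efx i k g hg).trans (hle i)
    · exact hefx k hk i hik g hg
  · have hik : i ≠ k := by rintro rfl; exact hself _ _ hb
    by_cases hk : Y k = X k
    · rw [hk] at he ⊢; exact (h.hold i k e he hb).trans (hle i)
    · exact hhold k hk i hik e he hb
  · have hik : i ≠ k := by rintro rfl; exact hself _ _ hb
    by_cases hk : Y k = X k
    · by_cases hi : Y i = X i
      · rw [hi] at he ⊢; rw [hk] at hf ⊢; exact h.both i k e he hb f hf hb'
      · rw [btw_comm, Set.union_comm]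
        rw [btw_comm] at hb hb'
        exact hboth i hi k hik.symm f hf hb' e he hb
    · exact hboth k hk i hik e he hb f hf hb'
  · by_cases hkz : k = z
    · subst hkz; exact le_rfl
    by_cases hz' : Y z = X z
    · rw [hz']; exact (h.free z hz k).trans (hle k)
    · exact (hfree z hz' hz k hkz).1
  · by_cases hkz : k = z
    · subst hkz; exact val_le_of_not_inc _ fun e he => absurd he.1 (hself _ _)
    by_cases hz' : Y z = X z
    · rw [hz']; exact (h.free_compl z hz k).trans (hle k)
    · exact (hfree z hz' hz k hkz).2.1
  · have hkz : k ≠ z := by rintro rfl; exact hself _ _ hb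
    by_cases hz' : Y z = X z
    · by_cases hk : Y k = X k
      · rw [hk] at he ⊢; rw [hz']; exact h.full z hz k e he hb
      · exact hfull k hk z hz hkz.symm e he hb
    · exact (hfree z hz' hz k hkz).2.2 e he hb

variable (P) in
/-- A state that no other state improves for some agent without a loss for another one. -/
def IsOptimal (F : Set I) (X : I → Set E) : Prop :=
  P.IsState F X ∧ ∀ Y, P.IsState F Y → (∀ i, P.val i (X i) ≤ P.val i (Y i)) →
    ∀ i, P.val i (Y i) ≤ P.val i (X i)

theorem IsState.exists_isOptimal [Finite I] [Finite E] (h : P.IsState F X) :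
    ∃ Y, P.IsOptimal F Y := by
  have := Fintype.ofFinite I
  obtain ⟨Y, hY, hmax⟩ := Set.exists_max_image {Y | P.IsState F Y}
    (fun Y => ∑ i, P.val i (Y i)) (Set.toFinite _) ⟨X, h⟩
  refine ⟨Y, hY, fun Z hZ hle i => ?_⟩
  by_contra! hlt
  have := Finset.sum_lt_sum (s := Finset.univ) (fun i _ => hle i) ⟨i, Finset.mem_univ i, hlt⟩
  exact absurd (hmax Z hZ) (not_le.2 this)

variable (P X) in
/-- The unallocated goods at the vertex `i`. -/
def rest (i : I) : Set E := {e | e ∈ P.inc i ∧ ∀ k, e ∉ X k}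

@[grind =] theorem mem_rest {i : I} {e : E} : e ∈ P.rest X i ↔ e ∈ P.inc i ∧ ∀ k, e ∉ X k := Iff.rfl

theorem notMem_btw_self {i : I} {e : E} : e ∉ P.btw i i := fun he => by
  have := P.src_ne_tgt e; grind

theorem IsOptimal.not_lt (h : P.IsOptimal F X) (hY : P.IsState F Y)
    (hle : ∀ i, P.val i (X i) ≤ P.val i (Y i)) (i : I) : ¬ P.val i (X i) < P.val i (Y i) :=
  (h.2 Y hY hle i).not_gt

/-! ### Exchanges that lead to new states. -/

open Classical in
/-- One agent outside `F` exchanges its bundle. -/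
theorem IsState.update_one (h : P.IsState F X) {s : I} (hs : s ∉ F) {A : Set E}
    (hle : P.val s (X s) ≤ P.val s A) (hinc : ∀ e ∈ A, e ∈ P.inc s)
    (hdisj : ∀ k, k ≠ s → ∀ e ∈ A, e ∉ X k)
    (hefx : ∀ i, i ≠ s → ∀ g ∈ A, P.val i (A \ {g}) ≤ P.val i (X i))
    (hhold : ∀ i, i ≠ s → ∀ e ∈ A, e ∈ P.btw i s → P.val i (P.btw i s \ A) ≤ P.val i (X i))
    (hboth : ∀ i, i ≠ s → ∀ e ∈ X i, e ∈ P.btw i s → ∀ f ∈ A, f ∈ P.btw i s →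
      P.btw i s ⊆ X i ∪ A)
    (hfull : ∀ z ∈ F, ∀ e ∈ A, e ∈ P.btw s z → P.btw s z ⊆ A ∪ X z) :
    P.IsState F (Function.update X s A) := by
  have key : ∀ k, Function.update X s A k ≠ X k → k = s := by
    intro k hk; by_contra hne; exact hk (Function.update_of_ne hne _ _)
  have hs' : Function.update X s A s = A := Function.update_self ..
  have hne : ∀ k, k ≠ s → Function.update X s A k = X k := fun k hk => Function.update_of_ne hk _ _
  refine h.of_changes (fun i => ?_) (fun i e he => ?_) (fun i j e hi hj => ?_)
    (fun k hk i hi => ?_) (fun k hk i hi => ?_) (fun k hk i hi => ?_) (fun k hk hkF => ?_)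
    (fun k hk z hz hzk => ?_)
  · by_cases hi : i = s
    · subst hi; rw [hs']; exact hle
    · rw [hne i hi]
  · by_cases hi : i = s
    · subst hi; rw [hs'] at he; exact hinc e he
    · rw [hne i hi] at he; exact h.inc i e he
  · by_cases hi' : i = s <;> by_cases hj' : j = s
    · rw [hi', hj']
    · subst hi'; rw [hs'] at hi; rw [hne j hj'] at hj; exact absurd hj (hdisj j hj' e hi)
    · subst hj'; rw [hs'] at hj; rw [hne i hi'] at hi; exact absurd hi (hdisj i hi' e hj)
    · rw [hne i hi'] at hi; rw [hne j hj'] at hj; exact h.disj i j e hi hj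
  · obtain rfl := key k hk; rw [hs', hne i hi]; exact hefx i hi
  · obtain rfl := key k hk; rw [hs', hne i hi]; exact hhold i hi
  · obtain rfl := key k hk; rw [hs', hne i hi]; exact hboth i hi
  · obtain rfl := key k hk; exact absurd hkF hs
  · obtain rfl := key k hk; rw [hs', hne z hzk]; exact hfull z hz

open Classical in
/-- The agents `s` and `p` outside `F` divide the goods between them anew, giving up everything
else, while `s` also takes unallocated goods from other pairs in which it holds nothing. -/
theorem IsState.update_two (h : P.IsState F X) {s p : I} (hs : s ∉ F) (hp : p ∉ F) (hsp : s ≠ p)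
    {A B T : Set E} (hB : B ⊆ P.btw s p) (hA : A = T ∪ (P.btw s p \ B))
    (hT : ∀ e ∈ T, e ∈ P.rest X s ∧ e ∉ P.btw s p)
    (hTi : ∀ i, i ≠ p → ∀ e ∈ T, e ∈ P.btw s i → (∀ f ∈ X s, f ∉ P.btw s i) ∧
      P.val i (P.rest X s ∩ P.btw s i) ≤ P.val i (X i) ∧ P.rest X s ∩ P.btw s i ⊆ T)
    (hles : P.val s (X s) ≤ P.val s A) (hlep : P.val p (X p) ≤ P.val p B)
    (hsB : ∀ g ∈ B, P.val s (B \ {g}) ≤ P.val s A) (hpA : ∀ g ∈ A, P.val p (A \ {g}) ≤ P.val p B) :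
    P.IsState F (Function.update (Function.update X s A) p B) := by
  set Y := Function.update (Function.update X s A) p B with hY
  have key : ∀ k, Y k ≠ X k → k = s ∨ k = p := by
    intro k hk; by_contra! hne
    exact hk (by rw [hY, Function.update_of_ne hne.2, Function.update_of_ne hne.1])
  have hp' : Y p = B := Function.update_self ..
  have hs' : Y s = A := by rw [hY, Function.update_of_ne hsp, Function.update_self]
  have hne : ∀ k, k ≠ s → k ≠ p → Y k = X k := fun k hk hk' => by
    rw [hY, Function.update_of_ne hk', Function.update_of_ne hk]
  have hAp : ∀ e, e ∈ A → e ∈ P.btw s p → e ∉ B := by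
    intro e he; rw [hA] at he; have := hT e; grind
  have hle : ∀ i, P.val i (X i) ≤ P.val i (Y i) := fun i => by
    by_cases hi : i = s
    · rw [hi, hs']; exact hles
    by_cases hi' : i = p
    · rw [hi', hp']; exact hlep
    rw [hne i hi hi']
  have hAi : ∀ i, i ≠ s → i ≠ p → ∀ e ∈ A, e ∈ P.inc i → e ∈ T ∧ e ∈ P.btw s i := by
    intro i hi hi' e he hei; rw [hA] at he; have := hT e; grind
  have hBi : ∀ i, i ≠ s → i ≠ p → ∀ e ∈ B, e ∉ P.inc i := by
    intro i hi hi' e he; have := hB he; grind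
  -- A third agent sees in `A` only unallocated goods between itself and `s`, which it tolerates by
  -- `hTi`.
  have hArest : ∀ i, i ≠ s → i ≠ p → P.val i A ≤ P.val i (X i) := by
    intro i hi hi'
    by_cases hex : ∃ e ∈ A, e ∈ P.inc i
    · obtain ⟨e, he, hei⟩ := hex
      obtain ⟨heT, heb⟩ := hAi i hi hi' e he hei
      refine le_trans (val_le fun f hf hfi => ?_) (hTi i hi' e heT heb).2.1
      obtain ⟨hfT, hfb⟩ := hAi i hi hi' f hf hfi
      exact ⟨(hT f hfT).1, hfb⟩
    · push Not at hex
      exact val_le_of_not_inc _ hex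
  refine h.of_changes hle (fun i e he => ?_) (fun i j e hi hj => ?_)
    (fun k hk i hi => ?_) (fun k hk i hi => ?_) (fun k hk i hi => ?_) (fun k hk hkF => ?_)
    (fun k hk z hz hzk => ?_)
  · by_cases hi : i = s
    · rw [hi, hs', hA] at he; have := hT e; grind
    by_cases hi' : i = p
    · rw [hi', hp'] at he; have := hB he; grind
    rw [hne i hi hi'] at he; exact h.inc i e he
  · have hkA : ∀ k, k ≠ s → k ≠ p → e ∈ A → e ∉ X k := by
      intro k hk hk' he hek
      have := hAi k hk hk' e he (h.inc k e hek)
      exact (hT e this.1).1.2 k hek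
    have hkB : ∀ k, k ≠ s → k ≠ p → e ∈ B → e ∉ X k := by
      intro k hk hk' he hek
      exact hBi k hk hk' e he (h.inc k e hek)
    have hAB : e ∈ A → e ∉ B := fun he he' => hAp e he (hB he') he'
    have := h.disj i j e
    have := hne i
    have := hne j
    grind
  · rcases key k hk with rfl | rfl
    · by_cases hip : i = p
      · subst hip; rw [hp', hs']; exact hpA
      · rw [hs', hne i hi hip]
        exact fun g _ => (val_mono Set.sdiff_subset).trans (hArest i hi hip)
    · by_cases his : i = s
      · subst his; rw [hp', hs']; exact hsB
      · rw [hp']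
        exact fun g _ => val_le_of_not_inc _ fun e he => hBi i his hi e he.1
  · rcases key k hk with rfl | rfl
    · rw [hs']
      intro e he heb
      by_cases hip : i = p
      · subst hip; rw [hp']
        refine val_mono fun f hf => ?_
        have := hf.1; have := hf.2; rw [hA] at this; grind
      · rw [hne i hi hip]
        obtain ⟨heT, heb'⟩ := hAi i hi hip e he (by grind)
        -- In this pair `s` held nothing and `T` takes every unallocated good, so whatever is
        -- outside `A` belongs to `i`.
        obtain ⟨h1, h2, h3⟩ := hTi i hip e heT heb'
        by_cases hex : ∃ f ∈ X i, f ∈ P.btw i k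
        · refine val_le fun f hf _ => ?_
          by_contra hfi
          have hfA := hf.2
          rw [hA] at hfA
          refine hfA (Or.inl (h3 ⟨⟨by have := hf.1; grind, fun l hl => ?_⟩, by
            rw [btw_comm]; exact hf.1⟩))
          have := h.inc l f hl
          have := h1 f
          have := hf.1
          grind
        · push Not at hex
          refine val_le fun f hf _ => ?_
          exfalso
          have hfA := hf.2
          rw [hA] at hfA
          refine hfA (Or.inl (h3 ⟨⟨by have := hf.1; grind, fun l hl => ?_⟩, by
            rw [btw_comm]; exact hf.1⟩))
          have := h.inc l f hl
          have := h1 f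
          have := hf.1
          have := hex f
          grind
    · rw [hp']
      intro e he heb
      have his : i = s := by have := hB he; have := hBi i; grind
      subst his
      rw [hs']
      refine val_mono fun f hf => ?_
      rw [hA]; exact Or.inr hf
  · rcases key k hk with rfl | rfl
    · rw [hs']
      intro e he heb f hf hfb
      by_cases hip : i = p
      · subst hip; rw [hp']
        intro g hg; rw [hA]; rw [btw_comm] at hg; by_cases hgB : g ∈ B
        · exact Or.inl hgB
        · exact Or.inr (Or.inr ⟨hg, hgB⟩)
      · rw [hne i hi hip] at he ⊢
        obtain ⟨hfT, hfb'⟩ := hAi i hi hip f hf (by grind)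
        obtain ⟨h1, h2, h3⟩ := hTi i hip f hfT hfb'
        intro g hg
        by_cases hgi : g ∈ X i
        · exact Or.inl hgi
        refine Or.inr ?_
        rw [hA]
        refine Or.inl (h3 ⟨⟨by grind, fun l hl => ?_⟩, by rw [btw_comm]; exact hg⟩)
        have := h.inc l g hl
        have := h1 g
        grind
    · rw [hp']
      intro e he heb f hf hfb
      have his : i = s := by have := hB hf; have := hBi i; grind
      subst his
      rw [hs']
      intro g hg; rw [hA]; by_cases hgB : g ∈ B
      · exact Or.inr hgB
      · exact Or.inl (Or.inr ⟨hg, hgB⟩)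
  · rcases key k hk with rfl | rfl
    · exact absurd hkF hs
    · exact absurd hkF hp
  · have hzs : z ≠ s := fun h => hs (h ▸ hz)
    have hzp : z ≠ p := fun h => hp (h ▸ hz)
    rw [hne z hzs hzp]
    rcases key k hk with rfl | rfl
    · rw [hs']
      intro e he heb
      obtain ⟨heT, heb'⟩ := hAi z hzs hzp e he (by grind)
      obtain ⟨h1, h2, h3⟩ := hTi z hzp e heT heb'
      intro g hg
      by_cases hgi : g ∈ X z
      · exact Or.inr hgi
      refine Or.inl ?_
      rw [hA]
      refine Or.inl (h3 ⟨⟨by grind, fun l hl => ?_⟩, hg⟩)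
      have := h.inc l g hl
      have := h1 g
      grind
    · rw [hp']
      intro e he heb
      exact absurd (by grind) (hBi z hzs hzp e he)

/-! ### Optimality: nobody wants the unallocated goods. -/

/-- In an optimal state, nobody outside `F` wants all goods of a pair outside `F` in which no good
is held. -/
theorem IsOptimal.val_btw_le (h : P.IsOptimal F X) [Finite E] {i j : I} (hi : i ∉ F) (hj : j ∉ F)
    (hij : i ≠ j) (hXi : ∀ e ∈ X i, e ∉ P.btw i j) (hXj : ∀ e ∈ X j, e ∉ P.btw i j) :
    P.val i (P.btw i j) ≤ P.val i (X i) := by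
  classical
  have single : ∀ i j : I, i ∉ F → i ≠ j → (∀ e ∈ X i, e ∉ P.btw i j) →
      (∀ e ∈ X j, e ∉ P.btw i j) → ∀ A ⊆ P.btw i j, P.val i (X i) < P.val i A →
      P.val j (P.btw i j \ A) ≤ P.val j (X j) →
      (∀ g ∈ A, P.val j (A \ {g}) ≤ P.val j (X j)) → j ∉ F → False := by
    intro i j hi hij hXi hXj A hA hlt hle hefx hj
    have hst := h.1.update_one hi hlt.le (A := A) (fun e he => by have := hA he; grind)
      (fun k hk e he hek => by have := hA he; have := h.1.inc k e hek; have := hXj e; grind)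
      (fun k hk g hg => by
        by_cases hkj : k = j
        · subst hkj; exact hefx g hg
        · exact val_le_of_not_inc _ fun e he => by have := hA he.1; grind)
      (fun k hk e he heb => by
        have hkj : k = j := by have := hA he; grind
        subst hkj; rw [btw_comm]; exact hle)
      (fun k hk e he heb f hf hfb => by
        have := hA hf; have := hXj e; grind)
      (fun z hz e he heb => by
        have := hA he; grind)
    refine h.not_lt hst (fun k => ?_) i (by rwa [Function.update_self])
    by_cases hk : k = i
    · subst hk; rw [Function.update_self]; exact hlt.le
    · rw [Function.update_of_ne hk]
  by_contra! hlt
  -- The thresholds are the present values, so each of the three outcomes is a state that is better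
  -- for `i` or `j` and worse for nobody.
  obtain ⟨A, hA, h1 | h2 | h3⟩ := exists_improving_cut (P.val i) (P.val j)
    (fun _ _ => val_mono) (fun _ _ => val_mono) (P.btw i j) _ (P.val j (X j)) (Or.inl hlt)
  · obtain ⟨h1, h2, h3, h4⟩ := h1
    have hAA : P.btw i j \ (P.btw i j \ A) = A := Set.sdiff_sdiff_cancel_left hA
    have hst := h.1.update_two hi hj hij (A := A) (B := P.btw i j \ A) (T := ∅)
      Set.sdiff_subset (by rw [hAA, Set.empty_union]) (by simp) (by simp) h1.le h2.le h3 h4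
    refine h.not_lt hst (fun k => ?_) i ?_
    · by_cases hk : k = j
      · subst hk; rw [Function.update_self]; exact h2.le
      rw [Function.update_of_ne hk]
      by_cases hk : k = i
      · subst hk; rw [Function.update_self]; exact h1.le
      · rw [Function.update_of_ne hk]
    · rwa [Function.update_of_ne hij, Function.update_self]
  · exact single i j hi hij hXi hXj A hA h2.1 h2.2.1 h2.2.2 hj
  · rw [btw_comm] at hA h3
    exact single j i hj hij.symm (by rwa [btw_comm]) (by rwa [btw_comm]) A hA h3.1 h3.2.1 h3.2.2 hi

/-- A bundle that an agent envies consists of goods at this agent. -/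
theorem IsState.subset_inc_of_envy (h : P.IsState F X) {p s : I}
    (hlt : P.val p (X p) < P.val p (X s)) : X s ⊆ P.inc p := by
  intro e he
  by_contra hep
  -- Removing a good that is not at `p` does not lower the value for `p`, so `efx` already rules out
  -- the envy.
  refine absurd hlt (not_lt.2 (le_trans (val_le fun f hf hfp => ?_) (h.efx p s e he)))
  exact ⟨hf, fun hfe => hep (by rw [← Set.mem_singleton_iff.1 hfe]; exact hfp)⟩

theorem nonempty_of_lt_val {p : I} {S T : Set E} (hlt : P.val p T < P.val p S) : S.Nonempty := by
  by_contra hcon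
  rw [Set.not_nonempty_iff_eq_empty] at hcon
  rw [hcon, P.val_empty] at hlt
  exact absurd (val_nonneg p T) (not_le.2 hlt)

/-- Otherwise `z` takes its unallocated goods and keeps its old ones only in pairs where the
neighbour also holds something. Those pairs are unchanged, having no unallocated good by `full`. In
every other pair `z` swaps its part for the complement, which merely interchanges `free` and
`free_compl`. The result is a better state. -/
theorem IsOptimal.val_rest_le_of_mem (h : P.IsOptimal F X) {z : I} (hz : z ∈ F) :
    P.val z (P.rest X z) ≤ P.val z (X z) := by
  classical
  by_contra! hlt
  set A : Set E := P.rest X z ∪ {e | e ∈ X z ∧ ∃ k, e ∈ P.btw k z ∧ ∃ f ∈ X k, f ∈ P.btw k z}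
    with hA
  have hzA : P.val z (X z) < P.val z A := hlt.trans_le (val_mono Set.subset_union_left)
  have hs' : Function.update X z A z = A := Function.update_self ..
  have hne : ∀ k, k ≠ z → Function.update X z A k = X k := fun k hk => Function.update_of_ne hk _ _
  have key : ∀ k, Function.update X z A k ≠ X k → k = z := by
    intro k hk; by_contra hne'; exact hk (hne k hne')
  have hfullz := h.1.full z hz
  have hcase : ∀ i, i ≠ z → (∃ f ∈ X i, f ∈ P.btw i z) → ∀ e ∈ P.btw i z, e ∈ A ↔ e ∈ X z := by
    rintro i hi ⟨f, hf, hfb⟩ e he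
    have hsub := hfullz i f hf hfb he
    refine ⟨fun heA => ?_, fun heX => Or.inr ⟨heX, i, he, f, hf, hfb⟩⟩
    rcases heA with heA | heA
    · exact absurd hsub (by rintro (h' | h') <;> exact heA.2 _ h')
    · exact heA.1
  have hcase' : ∀ i, i ≠ z → (∀ f ∈ X i, f ∉ P.btw i z) → ∀ e ∈ P.btw i z, e ∈ A ↔ e ∉ X z := by
    intro i hi hX e he
    refine ⟨fun heA heX => ?_, fun heX => Or.inl ⟨by grind, fun l hl => ?_⟩⟩
    · rcases heA with heA | ⟨_, k, hk, f, hf, hfb⟩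
      · exact heA.2 _ heX
      · have : k = i := by grind
        subst this; exact hX f hf hfb
    · have := h.1.inc l e hl
      have := hX e
      grind
  have hAi : ∀ i, i ≠ z → P.val i A ≤ P.val i (X i) ∧
      P.val i (P.btw i z \ A) ≤ P.val i (X i) ∧ ∀ e ∈ X i, e ∈ P.btw i z → P.btw i z ⊆ X i ∪ A := by
    intro i hi
    have hAinc : ∀ e ∈ A, e ∈ P.inc i → e ∈ P.btw i z := by
      intro e he hei
      have : e ∈ P.inc z := by
        rcases he with he | he
        · exact he.1
        · exact h.1.inc z e he.1
      grind
    by_cases hX : ∃ f ∈ X i, f ∈ P.btw i z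
    · have hc := hcase i hi hX
      refine ⟨le_trans (val_le fun e he hei => ?_) (h.1.free z hz i),
        le_trans (val_le fun e he hei => ?_) (h.1.free_compl z hz i), fun e he heb f hf => ?_⟩
      · exact (hc e (hAinc e he hei)).1 he
      · exact ⟨he.1, fun hX => he.2 ((hc e he.1).2 hX)⟩
      · have := hfullz i e he heb hf
        exact this.imp id (hc f hf).2
    · push Not at hX
      have hc := hcase' i hi hX
      refine ⟨le_trans (val_le fun e he hei => ?_) (h.1.free_compl z hz i),
        le_trans (val_le fun e he hei => ?_) (h.1.free z hz i), fun e he heb => absurd heb (hX e he)⟩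
      · exact ⟨hAinc e he hei, (hc e (hAinc e he hei)).1 he⟩
      · by_contra hX; exact he.2 ((hc e he.1).2 hX)
  have hAinc : ∀ e ∈ A, e ∈ P.inc z := by
    rintro e (he | he)
    · exact he.1
    · exact h.1.inc z e he.1
  have hAdisj : ∀ k, k ≠ z → ∀ e ∈ A, e ∉ X k := by
    rintro k hk e (he | he) heX
    · exact he.2 k heX
    · exact hk (h.1.disj _ _ e heX he.1)
  have hle : ∀ i, P.val i (X i) ≤ P.val i (Function.update X z A i) := fun i => by
    by_cases hi : i = z
    · subst hi; rw [hs']; exact hzA.le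
    · rw [hne i hi]
  have hst : P.IsState F (Function.update X z A) := by
    refine h.1.of_changes hle (fun i e he => ?_) (fun i j e hi hj => ?_)
      (fun k hk i hi => ?_) (fun k hk i hi => ?_) (fun k hk i hi => ?_) (fun k hk hkF i hi => ?_)
      (fun k hk y hy hyk => ?_)
    · by_cases hi : i = z
      · subst hi; rw [hs'] at he; exact hAinc e he
      · rw [hne i hi] at he; exact h.1.inc i e he
    · by_cases hi' : i = z <;> by_cases hj' : j = z
      · rw [hi', hj']
      · subst hi'; rw [hs'] at hi; rw [hne j hj'] at hj; exact absurd hj (hAdisj j hj' e hi)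
      · subst hj'; rw [hs'] at hj; rw [hne i hi'] at hi; exact absurd hi (hAdisj i hi' e hj)
      · rw [hne i hi'] at hi; rw [hne j hj'] at hj; exact h.1.disj i j e hi hj
    · obtain rfl := key k hk; rw [hs', hne i hi]
      exact fun g _ => (val_mono Set.sdiff_subset).trans (hAi i hi).1
    · obtain rfl := key k hk; rw [hs', hne i hi]
      exact fun _ _ _ => (hAi i hi).2.1
    · obtain rfl := key k hk; rw [hs', hne i hi]
      exact fun e he heb _ _ _ => (hAi i hi).2.2 e he heb
    · obtain rfl := key k hk; rw [hs', hne i hi]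
      exact hAi i hi
    · obtain rfl := key k hk; rw [hs', hne y hyk]
      intro e he heb
      by_cases hX : ∃ f ∈ X y, f ∈ P.btw y k
      · obtain ⟨f, hf, hfb⟩ := hX
        rw [btw_comm, Set.union_comm]; exact (hAi y hyk).2.2 f hf hfb
      · push Not at hX
        intro f hf
        by_cases hfA : f ∈ A
        · exact Or.inl hfA
        · have hfX : f ∈ X k := by
            by_contra hcon
            exact hfA ((hcase' y hyk hX f (by rw [btw_comm]; exact hf)).2 hcon)
          have := h.1.full y hy k f hfX hf (by rw [btw_comm]; rw [btw_comm] at heb; exact heb)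
          have h1 := (hcase' y hyk hX e (by rw [btw_comm]; exact heb)).1 he
          have h2 := hX e
          grind
  exact h.not_lt hst hle z (by rwa [hs'])

/-- In an optimal state, an agent outside `F` does not want the unallocated goods that it shares with
the agents in `J`, if each of these tolerates that it takes them. -/
theorem IsOptimal.val_rest_inter_le (h : P.IsOptimal F X) {s : I} (hs : s ∉ F) (J : Set I)
    (hJ : ∀ k ∈ J, P.val k (P.rest X s ∩ P.btw s k) ≤ P.val k (X k)) :
    P.val s {e | e ∈ P.rest X s ∧ ∃ k ∈ J, e ∈ P.btw s k} ≤ P.val s (X s) := by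
  classical
  by_contra! hlt
  set T : Set E := {e | e ∈ P.rest X s ∧ ∃ k ∈ J, e ∈ P.btw s k} with hT
  have hTk : ∀ i, ∀ e ∈ T, e ∈ P.btw s i → i ∈ J := by
    rintro i e ⟨_, k, hk, heb⟩ hei
    have : i = k := by grind
    rwa [this]
  have hTi : ∀ i ∈ J, P.rest X s ∩ P.btw s i ⊆ T := fun i hi e he => ⟨he.1, i, hi, he.2⟩
  have hmem : ∀ i ∈ J, ∀ e ∈ P.btw s i, e ∉ T → e ∈ X i ∨ e ∈ X s := by
    intro i hi e he heT
    by_contra! hcon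
    refine heT (hTi i hi ⟨⟨by grind, fun l hl => ?_⟩, he⟩)
    have := h.1.inc l e hl
    grind
  -- If some `p` outside `F` envies `s`, then `X s` lies in their pair: `p` takes it over, and `s`
  -- takes the rest of the pair with the part of `T` outside it. Both gain, and `hold` bounds what
  -- `p` sees in the new bundle of `s`.
  by_cases hp : ∃ p, p ∉ F ∧ P.val p (X p) < P.val p (X s)
  · obtain ⟨p, hpF, hp⟩ := hp
    have hsp : s ≠ p := by rintro rfl; exact lt_irrefl _ hp
    have hXsp : X s ⊆ P.btw s p := fun e he => by
      have := h.1.subset_inc_of_envy hp he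
      have := h.1.inc s e he
      grind
    have hTA : T ⊆ (T \ P.btw s p) ∪ (P.btw s p \ X s) := by
      intro e he
      by_cases heb : e ∈ P.btw s p
      · exact Or.inr ⟨heb, he.1.2 s⟩
      · exact Or.inl ⟨he, heb⟩
    have hsA : P.val s (X s) < P.val s ((T \ P.btw s p) ∪ (P.btw s p \ X s)) :=
      hlt.trans_le (val_mono hTA)
    obtain ⟨e₀, he₀⟩ := nonempty_of_lt_val hp
    have hst := h.1.update_two hs hpF hsp (A := (T \ P.btw s p) ∪ (P.btw s p \ X s)) (B := X s)
      (T := T \ P.btw s p) hXsp rfl (fun e he => ⟨he.1.1, he.2⟩)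
      (fun i hi e he heb => ⟨fun f hf hfb => by have := hXsp hf; grind,
        hJ i (hTk i e he.1 heb), fun f hf => ⟨hTi i (hTk i e he.1 heb) hf, by
          have := hf.2; grind⟩⟩)
      hsA.le hp.le (fun g _ => (val_mono Set.sdiff_subset).trans hsA.le)
      (fun g _ => by
        refine le_trans (val_le fun f hf hfp => ?_)
          ((h.1.hold p s e₀ he₀ (by rw [btw_comm]; exact hXsp he₀)).trans hp.le)
        rcases hf.1 with hf | hf
        · have := hf.1.1.1; have := hf.2; grind
        · rw [btw_comm]; exact hf)
    refine h.not_lt hst (fun k => ?_) p (by rwa [Function.update_self])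
    by_cases hk : k = p
    · subst hk; rw [Function.update_self]; exact hp.le
    rw [Function.update_of_ne hk]
    by_cases hk : k = s
    · subst hk; rw [Function.update_self]; exact hsA.le
    · rw [Function.update_of_ne hk]
  · push Not at hp
    -- Without such envy, `s` simply replaces `X s` by `T`. In a pair met by `T`, either `s` held
    -- nothing, or the other end is outside `F` and held nothing; in the latter case the goods that
    -- become free lie in `X s`, which that end does not envy.
    have hXs : ∀ i, ∀ e ∈ T, e ∈ P.btw s i → i ∈ F ∨ (∃ f ∈ X i, f ∈ P.btw s i) →
        ∀ f ∈ X s, f ∉ P.btw s i := by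
      rintro i e he heb (hi | ⟨g, hg, hgb⟩) f hf hfb
      · have := h.1.full i hi s f hf hfb heb
        exact this.elim (he.1.2 _) (he.1.2 _)
      · have := h.1.both s i f hf hfb g hg hgb heb
        exact this.elim (he.1.2 _) (he.1.2 _)
    have hst := h.1.update_one hs hlt.le (A := T) (fun e he => he.1.1)
      (fun k _ e he => he.1.2 k)
      (fun i hi g hg => by
        refine (val_mono Set.sdiff_subset).trans ?_
        by_cases hex : ∃ e ∈ T, e ∈ P.inc i
        · obtain ⟨e, he, hei⟩ := hex
          have hei : e ∈ P.btw s i := by have := he.1.1; grind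
          refine le_trans (val_le ?_) (hJ i (hTk i e he hei))
          intro f hf hfi
          exact ⟨hf.1, by have := hf.1.1; grind⟩
        · push Not at hex
          exact val_le_of_not_inc _ hex)
      (fun i hi e he heb => by
        rw [btw_comm] at heb ⊢
        have hiJ := hTk i e he heb
        by_cases hex : i ∈ F ∨ ∃ f ∈ X i, f ∈ P.btw s i
        · have := hXs i e he heb hex
          exact val_mono fun f hf => (hmem i hiJ f hf.1 hf.2).resolve_right fun h' => this f h' hf.1
        · push Not at hex
          refine le_trans (val_mono fun f hf => ?_) (hp i hex.1)
          exact (hmem i hiJ f hf.1 hf.2).resolve_left fun h' => hex.2 f h' hf.1)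
      (fun i hi e he heb f hf hfb => by
        rw [btw_comm] at heb hfb ⊢
        have := hXs i f hf hfb (Or.inr ⟨e, he, heb⟩)
        intro g hg
        by_cases hgT : g ∈ T
        · exact Or.inr hgT
        · exact Or.inl ((hmem i (hTk i f hf hfb) g hg hgT).resolve_right fun h' => this g h' hg))
      (fun z hz e he heb => by
        have := hXs z e he heb (Or.inl hz)
        intro g hg
        by_cases hgT : g ∈ T
        · exact Or.inl hgT
        · exact Or.inr ((hmem z (hTk z e he heb) g hg hgT).resolve_right fun h' => this g h' hg))
    refine h.not_lt hst (fun k => ?_) s (by rwa [Function.update_self])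
    by_cases hk : k = s
    · subst hk; rw [Function.update_self]; exact hlt.le
    · rw [Function.update_of_ne hk]

/-- In an optimal state, nobody wants the unallocated goods. -/
theorem IsOptimal.val_rest_le [Finite E] (h : P.IsOptimal F X) (i : I) :
    P.val i (P.rest X i) ≤ P.val i (X i) := by
  by_cases hi : i ∈ F
  · exact h.val_rest_le_of_mem hi
  -- If `i` holds a good of the pair, `hold` makes `j` tolerate the rest, so by optimality `i`
  -- cannot want it. If `j` holds one, `hold` applies to `i` directly.
  have hpair : ∀ i j, i ∉ F → j ∉ F → P.val i (P.rest X i ∩ P.btw i j) ≤ P.val i (X i) := by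
    intro i j hi hj
    by_cases hXi : ∃ e ∈ X i, e ∈ P.btw i j
    · obtain ⟨e, he, heb⟩ := hXi
      refine le_trans (val_mono ?_) (h.val_rest_inter_le hi {j} ?_)
      · exact fun f hf => ⟨hf.1, j, rfl, hf.2⟩
      · rintro k rfl
        refine le_trans (val_mono fun f hf => ?_) (h.1.hold k i e he (by rwa [btw_comm]))
        exact ⟨by rw [btw_comm]; exact hf.2, hf.1.2 i⟩
    by_cases hXj : ∃ e ∈ X j, e ∈ P.btw i j
    · obtain ⟨e, he, heb⟩ := hXj
      refine le_trans (val_mono ?_) (h.1.hold i j e he heb)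
      exact fun f hf => ⟨hf.2, hf.1.2 j⟩
    push Not at hXi hXj
    by_cases hij : i = j
    · subst hij
      exact val_le_of_not_inc _ fun e he => absurd he.2 notMem_btw_self
    · exact (val_mono Set.inter_subset_right).trans (h.val_btw_le hi hj hij hXi hXj)
  -- Every neighbour is now known to tolerate its share, so `J` may consist of all agents.
  refine le_trans (val_mono fun e he => ?_) (h.val_rest_inter_le hi Set.univ fun k _ => ?_)
  · rcases he.1 with hs | ht
    · exact ⟨he, P.tgt e, trivial, Or.inl ⟨hs, rfl⟩⟩
    · exact ⟨he, P.src e, trivial, Or.inr ⟨rfl, ht⟩⟩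
  · by_cases hk : k ∈ F
    · refine le_trans (val_mono fun e he => ?_) (h.val_rest_le_of_mem hk)
      exact ⟨by have := he.2; grind, he.1.2⟩
    · refine le_trans (val_mono fun e he => ?_) (hpair k i hk hi)
      exact ⟨⟨by have := he.2; grind, he.1.2⟩, by rw [btw_comm]; exact he.2⟩

theorem btw_right_unique {i k l : I} {e : E} (hk : e ∈ P.btw i k) (hl : e ∈ P.btw i l) :
    k = l := by
  grind

theorem eq_or_eq_of_mem_btw {i j k : I} {e : E} (h : e ∈ P.btw i j) (hk : e ∈ P.inc k) :
    k = i ∨ k = j := by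
  grind

theorem mem_btw_of_ne {i j : I} {e : E} (hi : e ∈ P.inc i) (hj : e ∈ P.inc j) (hij : i ≠ j) :
    e ∈ P.btw i j := by
  grind

theorem mem_inc_left {i j : I} {e : E} (h : e ∈ P.btw i j) : e ∈ P.inc i := by
  grind

theorem mem_inc_right {i j : I} {e : E} (h : e ∈ P.btw i j) : e ∈ P.inc j := by
  grind

theorem btw_left_unique {i j k : I} {e : E} (hi : e ∈ P.btw i k) (hj : e ∈ P.btw j k) :
    i = j := by
  grind

/-! ### Existence of a state. -/

/-- A division of the goods between `z` and `k` that is acceptable for `z` whichever part `k` takes. -/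
theorem exists_pieces (P : Market I E) [Finite E] (z k : I) :
    ∃ A : Bool → Set E, (∀ b, A b ⊆ P.btw z k) ∧ (∀ b, ∀ e ∈ P.btw z k, e ∈ A (!b) ↔ e ∉ A b) ∧
      (∀ b, P.val z (A true) ≤ P.val z (A b)) ∧
      ∀ b, ∀ g ∈ A b, P.val z (A b \ {g}) ≤ P.val z (A true) := by
  -- The reference set `∅` is a dummy, as the lower bound on the poorer part is discarded. The index
  -- `true` will denote the poorer part.
  obtain ⟨A, hA, h1, h2, -⟩ := exists_efx_cut (P.val z) (fun _ _ => val_mono) (P.btw z k) ∅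
    (Set.empty_subset _)
  refine ⟨fun b => cond b A (P.btw z k \ A), ?_, ?_, ?_, ?_⟩
  · rintro (_ | _)
    · exact Set.sdiff_subset
    · exact hA
  · rintro (_ | _) e he <;> simp [he]
  · rintro (_ | _)
    · exact h2
    · exact le_rfl
  · rintro (_ | _)
    · exact h1
    · exact fun g _ => val_mono Set.sdiff_subset

/-- If no good joins two vertices in `F`, there is a state. -/
theorem exists_isState [Finite I] [Finite E] (P : Market I E) {F : Set I}
    (hF : ∀ z ∈ F, ∀ z' ∈ F, ∀ e, e ∉ P.btw z z') : ∃ X, P.IsState F X := by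
  classical
  rcases F.eq_empty_or_nonempty with rfl | hne
  · refine ⟨fun _ => ∅, ?_⟩
    constructor <;> simp
  have : Nonempty F := hne.to_subtype
  choose A hsub hcompl hmin hefx using exists_pieces P
  have hbest : ∀ k : I, ∃ p : F × Bool, ∀ q : F × Bool,
      P.val k (A q.1 k q.2) ≤ P.val k (A p.1 k p.2) := fun k =>
    Finite.exists_max (fun q : F × Bool => P.val k (A q.1 k q.2))
  choose p hp using hbest
  -- In the pair from which `k` chose its part, `z` gets the other part; in the remaining pairs of
  -- `z` either part would do.
  obtain ⟨q, hqp⟩ : ∃ q : I → I → Bool, ∀ k, q (p k).1 k = !(p k).2 :=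
    ⟨fun z k => if (p k).1 = z then !(p k).2 else true, fun k => by simp⟩
  obtain ⟨X, hXF, hXR⟩ : ∃ X : I → Set E, (∀ z ∈ F, ∀ e, e ∈ X z ↔ ∃ k ∉ F, e ∈ A z k (q z k)) ∧
      ∀ k ∉ F, X k = A (p k).1 k (p k).2 :=
    ⟨fun i => if i ∈ F then {e | ∃ k ∉ F, e ∈ A i k (q i k)} else A (p i).1 i (p i).2,
      fun z hz e => by simp [hz], fun k hk => by simp [hk]⟩
  have hat : ∀ z ∈ F, ∀ k ∉ F, ∀ e ∈ P.btw z k, e ∈ X z ↔ e ∈ A z k (q z k) := by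
    intro z hz k hk e he
    rw [hXF z hz]
    refine ⟨fun ⟨l, hl, hel⟩ => ?_, fun h => ⟨k, hk, h⟩⟩
    rwa [btw_right_unique (hsub z l _ hel) he] at hel
  have hRF : ∀ k ∉ F, ∀ e ∈ X k, e ∈ P.btw (p k).1 k := by
    intro k hk e he; rw [hXR k hk] at he; exact hsub _ _ _ he
  have hFR : ∀ z ∈ F, ∀ e ∈ X z, ∃ k ∉ F, e ∈ P.btw z k := by
    intro z hz e he
    obtain ⟨k, hk, hek⟩ := (hXF z hz e).1 he
    exact ⟨k, hk, hsub _ _ _ hek⟩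
  have hbest : ∀ k ∉ F, ∀ z ∈ F, ∀ b, P.val k (A z k b) ≤ P.val k (X k) := by
    intro k hk z hz b; rw [hXR k hk]; exact hp k (⟨z, hz⟩, b)
  have hlow : ∀ z ∈ F, ∀ k ∉ F, P.val z (A z k true) ≤ P.val z (X z) := fun z hz k hk =>
    (hmin z k (q z k)).trans (val_mono fun e he => (hat z hz k hk e (hsub _ _ _ he)).2 he)
  have hpF : ∀ k, ((p k).1 : I) ∈ F := fun k => (p k).1.2
  have hinc : ∀ i, ∀ e ∈ X i, e ∈ P.inc i := by
    intro i e he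
    by_cases hi : i ∈ F
    · obtain ⟨k, -, hk⟩ := hFR i hi e he
      exact mem_inc_left hk
    · exact mem_inc_right (hRF i hi e he)
  have hdisj : ∀ z ∈ F, ∀ k ∉ F, ∀ e ∈ X z, e ∉ X k := by
    intro z hz k hk e he hek
    have h1 := hRF k hk e hek
    obtain ⟨l, hl, hel⟩ := hFR z hz e he
    have hzp : z = (p k).1 :=
      (eq_or_eq_of_mem_btw h1 (mem_inc_left hel)).resolve_right fun hzk => hk (hzk ▸ hz)
    rw [hzp] at he
    have h2 := (hat _ (hpF k) k hk e h1).1 he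
    rw [hqp, hcompl _ _ _ e h1] at h2
    rw [hXR k hk] at hek
    exact h2 hek
  have hfree : ∀ z ∈ F, ∀ k, P.val k (X z) ≤ P.val k (X k) := by
    intro z hz k
    by_cases hk : k ∈ F
    · by_cases hkz : k = z
      · rw [hkz]
      · refine val_le_of_not_inc _ fun e he hek => ?_
        exact hF k hk z hz e (mem_btw_of_ne hek (hinc z e he) hkz)
    · refine le_trans (val_le fun e he hek => ?_) (hbest k hk z hz (q z k))
      have hb : e ∈ P.btw z k := mem_btw_of_ne (hinc z e he) hek fun hzk => hk (hzk ▸ hz)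
      exact (hat z hz k hk e hb).1 he
  have hfc : ∀ z ∈ F, ∀ k, P.val k (P.btw k z \ X z) ≤ P.val k (X k) := by
    intro z hz k
    by_cases hk : k ∈ F
    · exact val_le_of_not_inc _ fun e he => absurd he.1 (hF k hk z hz e)
    · refine le_trans (val_mono fun e he => ?_) (hbest k hk z hz (!q z k))
      have hb : e ∈ P.btw z k := by rw [btw_comm]; exact he.1
      rw [hcompl _ _ _ e hb, ← hat z hz k hk e hb]
      exact he.2
  have hpeq : ∀ k ∉ F, ∀ z ∈ F, ∀ e ∈ X k, e ∈ P.inc z → z = (p k).1 := by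
    intro k hk z hz e he hez
    exact (eq_or_eq_of_mem_btw (hRF k hk e he) hez).resolve_right fun hzk => hk (hzk ▸ hz)
  have hfull : ∀ z ∈ F, ∀ k, ∀ e ∈ X k, e ∈ P.btw k z → P.btw k z ⊆ X k ∪ X z := by
    intro z hz k e he hb
    have hk : k ∉ F := fun hk => hF k hk z hz e hb
    obtain rfl := hpeq k hk z hz e he (mem_inc_right hb)
    intro f hf
    rw [btw_comm] at hf
    by_cases hfX : f ∈ X k
    · exact Or.inl hfX
    · refine Or.inr ((hat _ hz k hk f hf).2 ?_)
      rw [hqp, hcompl _ _ _ f hf, ← hXR k hk]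
      exact hfX
  refine ⟨X, hinc, ?_, ?_, ?_, ?_, hfree, hfc, hfull⟩
  · intro i j e hi hj
    by_cases hiF : i ∈ F <;> by_cases hjF : j ∈ F
    · by_contra hij
      exact hF i hiF j hjF e (mem_btw_of_ne (hinc i e hi) (hinc j e hj) hij)
    · exact absurd hj (hdisj i hiF j hjF e hi)
    · exact absurd hi (hdisj j hjF i hiF e hj)
    · exact ((eq_or_eq_of_mem_btw (hRF i hiF e hi) (hinc j e hj)).resolve_left
        fun h => hjF (h ▸ hpF i)).symm
  · intro i k g hg
    by_cases hk : k ∈ F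
    · exact (val_mono Set.sdiff_subset).trans (hfree k hk i)
    by_cases hik : i = k
    · rw [hik]; exact val_mono Set.sdiff_subset
    by_cases hi : i = (p k).1
    · rw [hi, hXR k hk]
      rw [hXR k hk] at hg
      exact (hefx _ _ _ g hg).trans (hlow _ (hpF k) k hk)
    · exact val_le_of_not_inc _ fun e he hei =>
        (eq_or_eq_of_mem_btw (hRF k hk e he.1) hei).elim hi hik
  · intro i k e he hb
    by_cases hk : k ∈ F
    · exact hfc k hk i
    have h1 := hRF k hk e he
    have hi : i = (p k).1 := btw_left_unique hb h1
    subst hi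
    refine val_mono fun f hf => ?_
    rw [hat _ (hpF k) k hk f hf.1, hqp, hcompl _ _ _ f hf.1, ← hXR k hk]
    exact hf.2
  · intro i k e he hb f hf hfb
    by_cases hk : k ∈ F
    · exact hfull k hk i e he hb
    by_cases hi : i ∈ F
    · rw [btw_comm, Set.union_comm]
      exact hfull i hi k f hf (by rwa [btw_comm])
    · exact absurd (btw_left_unique hfb (hRF k hk f hf) ▸ hpF k) hi

/-! ### Completing an optimal state. -/

variable (P) in
/-- There is a complete allocation that is envy-free up to any good. -/
def HasEFX : Prop :=
  ∃ Z : I → Set E, (∀ i j e, e ∈ Z i → e ∈ Z j → i = j) ∧ (∀ e, ∃ i, e ∈ Z i) ∧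
    ∀ i j, ∀ g ∈ Z j, P.val i (Z j \ {g}) ≤ P.val i (Z i)

/-- The unallocated goods of an optimal state can be given to vertices in `F` that are not
adjacent to their ends. -/
theorem IsOptimal.hasEFX_of_dump [Finite E] (h : P.IsOptimal F X) (τ : E → I) (hτ : ∀ e, τ e ∈ F)
    (hadj : ∀ e i, e ∈ P.inc i → ∀ f, f ∉ P.btw i (τ e)) : P.HasEFX := by
  refine ⟨fun i => X i ∪ {e | (∀ k, e ∉ X k) ∧ τ e = i}, ?_, fun e => ?_, fun i j g hg => ?_⟩
  · rintro i j e (hi | hi) (hj | hj)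
    · exact h.1.disj i j e hi hj
    · exact absurd hi (hj.1 i)
    · exact absurd hj (hi.1 j)
    · exact hi.2.symm.trans hj.2
  · by_cases he : ∃ k, e ∈ X k
    · exact he.imp fun k hk => Or.inl hk
    · push Not at he
      exact ⟨τ e, Or.inr ⟨he, rfl⟩⟩
  · by_cases hij : i = j
    · subst hij; exact val_mono Set.sdiff_subset
    refine le_trans ?_ (val_mono Set.subset_union_left)
    by_cases hD : ∃ e, (∀ k, e ∉ X k) ∧ τ e = j
    · obtain ⟨e₀, -, rfl⟩ := hD
      refine (val_mono Set.sdiff_subset).trans ?_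
      -- A neighbour of `τ e₀` sees none of the goods dumped there; any other agent sees nothing
      -- else in that bundle.
      by_cases hf : ∃ f, f ∈ P.btw i (τ e₀)
      · obtain ⟨f, hf⟩ := hf
        refine le_trans (val_le ?_) (h.1.free _ (hτ e₀) i)
        rintro e (he | he) hei
        · exact he
        · exact absurd hf (he.2 ▸ hadj e i hei f)
      · push Not at hf
        refine le_trans (val_le ?_) (h.val_rest_le i)
        rintro e (he | he) hei
        · exact absurd (mem_btw_of_ne hei (h.1.inc _ e he) hij) (hf e)
        · exact ⟨hei, he.1⟩
    · push Not at hD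
      have hXj : X j ∪ {e | (∀ k, e ∉ X k) ∧ τ e = j} = X j :=
        Set.union_eq_left.2 fun e he => absurd he.2 (hD e he.1)
      beta_reduce at hg ⊢
      rw [hXj] at hg ⊢
      exact h.1.efx i j g hg

open Classical in
/-- In an optimal state, an agent outside `F` which is envied by an agent in `F` does not prefer
their other goods together with its unallocated goods. -/
theorem IsOptimal.val_le_of_envy [Finite E] (h : P.IsOptimal F X)
    (hF : ∀ z ∈ F, ∀ z' ∈ F, ∀ e, e ∉ P.btw z z') {z k : I} (hz : z ∈ F) (hk : k ∉ F)
    (hlt : P.val z (X z) < P.val z (X k)) :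
    P.val k (P.rest X k ∪ (P.btw k z \ X k)) ≤ P.val k (X k) := by
  by_contra! hlt'
  have hkz : k ≠ z := fun h => hk (h ▸ hz)
  -- The envied bundle `X k` lies in the pair of `k` and `z`, which is fully allocated by `full`. So
  -- `k` and `z` can exchange their parts of it, while `k` also takes all its unallocated goods.
  set Y := Function.update (Function.update X k (P.rest X k ∪ (P.btw k z \ X k))) z
    ((X z \ P.btw k z) ∪ X k) with hY
  have hYz : Y z = (X z \ P.btw k z) ∪ X k := Function.update_self ..
  have hYk : Y k = P.rest X k ∪ (P.btw k z \ X k) := by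
    rw [hY, Function.update_of_ne hkz, Function.update_self]
  have hne : ∀ i, i ≠ k → i ≠ z → Y i = X i := fun i hi hi' => by
    rw [hY, Function.update_of_ne hi', Function.update_of_ne hi]
  clear_value Y
  have key : ∀ i, Y i ≠ X i → i = k ∨ i = z := by
    intro i hi; by_contra! hcon; exact hi (hne i hcon.1 hcon.2)
  have hXk : X k ⊆ P.btw k z := fun e he =>
    mem_btw_of_ne (h.1.inc k e he) (h.1.subset_inc_of_envy hlt he) hkz
  obtain ⟨e₀, he₀⟩ := nonempty_of_lt_val hlt
  have hsub : P.btw k z ⊆ X k ∪ X z := h.1.full z hz k e₀ he₀ (hXk he₀)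
  have hrest : ∀ e ∈ P.rest X k, e ∉ P.btw k z := fun e he hb =>
    (hsub hb).elim (he.2 k) (he.2 z)
  have hle : ∀ i, P.val i (X i) ≤ P.val i (Y i) := fun i => by
    by_cases hi : i = k
    · subst hi; rw [hYk]; exact hlt'.le
    by_cases hi' : i = z
    · subst hi'; rw [hYz]; exact hlt.le.trans (val_mono Set.subset_union_right)
    rw [hne i hi hi']
  have hYki : ∀ i, i ≠ k → i ≠ z → ∀ e ∈ Y k, e ∈ P.inc i → e ∈ P.rest X i := by
    intro i hi hi' e he hei
    rw [hYk] at he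
    rcases he with he | he
    · exact ⟨hei, he.2⟩
    · exact ((eq_or_eq_of_mem_btw he.1 hei).elim hi hi').elim
  have hYzi : ∀ i, i ≠ k → i ≠ z → ∀ e ∈ P.inc i, e ∈ Y z ↔ e ∈ X z := by
    intro i hi hi' e hei
    have hb : e ∉ P.btw k z := fun hb => (eq_or_eq_of_mem_btw hb hei).elim hi hi'
    rw [hYz]
    exact ⟨fun he => he.elim (fun he => he.1) fun he => absurd (hXk he) hb,
      fun he => Or.inl ⟨he, hb⟩⟩
  have hcovz : P.btw k z ⊆ Y k ∪ Y z := by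
    intro g hg
    rw [hYk, hYz]
    by_cases hgk : g ∈ X k
    · exact Or.inr (Or.inr hgk)
    · exact Or.inl (Or.inr ⟨hg, hgk⟩)
  have hcov : ∀ i, i ≠ k → P.btw i k ⊆ Y i ∪ Y k := by
    intro i hi
    by_cases hi' : i = z
    · rw [hi', btw_comm, Set.union_comm]; exact hcovz
    intro g hg
    rw [hne i hi hi', hYk]
    by_cases hgi : g ∈ X i
    · exact Or.inl hgi
    refine Or.inr (Or.inl ⟨mem_inc_right hg, fun l hl => ?_⟩)
    rcases eq_or_eq_of_mem_btw hg (h.1.inc l g hl) with rfl | rfl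
    · exact hgi hl
    · exact (eq_or_eq_of_mem_btw (hXk hl) (mem_inc_left hg)).elim hi hi'
  have hYk_le : ∀ i, i ≠ k → P.val i (Y k) ≤ P.val i (Y i) := by
    intro i hi
    by_cases hi' : i = z
    · subst hi'
      refine le_trans (val_le ?_) ((h.1.hold i k e₀ he₀ (by rw [btw_comm]; exact hXk he₀)).trans
        (hle i))
      intro e he hei
      rw [hYk] at he
      rcases he with he | he
      · exact absurd (mem_btw_of_ne he.1 hei hkz) (hrest e he)
      · rwa [btw_comm]
    · rw [hne i hi hi']
      exact (val_le (hYki i hi hi')).trans (h.val_rest_le i)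
  have hdisj : ∀ i, i ≠ k → i ≠ z → ∀ e ∈ X i, e ∉ Y k ∧ e ∉ Y z := by
    intro i hi hi' e he
    have hei := h.1.inc i e he
    exact ⟨fun hek => (hYki i hi hi' e hek hei).2 i he,
      fun hez => hi' (h.1.disj _ _ e he ((hYzi i hi hi' e hei).1 hez))⟩
  have hkzd : ∀ e ∈ Y k, e ∉ Y z := by
    intro e he hez
    rw [hYk] at he; rw [hYz] at hez
    rcases he with he | he <;> rcases hez with hez | hez
    · exact he.2 z hez.1
    · exact he.2 k hez
    · exact hez.2 he.1
    · exact he.2 hez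
  have hzfree : ∀ i, i ≠ z → P.val i (Y z) ≤ P.val i (Y i) ∧
      P.val i (P.btw i z \ Y z) ≤ P.val i (Y i) ∧
      ∀ e ∈ Y i, e ∈ P.btw i z → P.btw i z ⊆ Y i ∪ Y z := by
    intro i hi'
    by_cases hi : i = k
    · subst hi
      refine ⟨le_trans (val_le ?_) (hle i), val_mono ?_, fun _ _ _ => hcovz⟩
      · intro e he hei
        rw [hYz] at he
        rcases he with he | he
        · exact absurd (mem_btw_of_ne hei (h.1.inc z e he.1) hkz) he.2
        · exact he
      · exact fun e he => (hcovz he.1).resolve_right he.2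
    · rw [hne i hi hi']
      refine ⟨le_trans (val_le ?_) (h.1.free z hz i), le_trans (val_mono ?_)
        (h.1.free_compl z hz i), fun e he heb f hf => ?_⟩
      · exact fun e he hei => (hYzi i hi hi' e hei).1 he
      · exact fun e he => ⟨he.1, fun hX => he.2 ((hYzi i hi hi' e (mem_inc_left he.1)).2 hX)⟩
      · exact (h.1.full z hz i e he heb hf).imp id (hYzi i hi hi' f (mem_inc_left hf)).2
  have hst : P.IsState F Y := by
    refine h.1.of_changes hle (fun i e he => ?_) (fun i j e hi hj => ?_)
      (fun l hl i hi => ?_) (fun l hl i hi => ?_) (fun l hl i hi => ?_) (fun l hl hlF => ?_)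
      (fun l hl y hy hyl => ?_)
    · by_cases hi : i = k
      · subst hi; rw [hYk] at he
        exact he.elim (fun he => he.1) fun he => mem_inc_left he.1
      by_cases hi' : i = z
      · subst hi'; rw [hYz] at he
        exact he.elim (fun he => h.1.inc _ e he.1) fun he => mem_inc_right (hXk he)
      · rw [hne i hi hi'] at he; exact h.1.inc i e he
    · rcases eq_or_ne i k with rfl | hik
      · rcases eq_or_ne j i with rfl | hjk
        · rfl
        rcases eq_or_ne j z with rfl | hjz
        · exact absurd hj (hkzd e hi)
        · exact absurd hi (hdisj j hjk hjz e (hne j hjk hjz ▸ hj)).1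
      rcases eq_or_ne i z with rfl | hiz
      · rcases eq_or_ne j k with rfl | hjk
        · exact absurd hi (hkzd e hj)
        rcases eq_or_ne j i with rfl | hjz
        · rfl
        · exact absurd hi (hdisj j hjk hjz e (hne j hjk hjz ▸ hj)).2
      have hXi : e ∈ X i := hne i hik hiz ▸ hi
      rcases eq_or_ne j k with rfl | hjk
      · exact absurd hj (hdisj i hik hiz e hXi).1
      rcases eq_or_ne j z with rfl | hjz
      · exact absurd hj (hdisj i hik hiz e hXi).2
      · exact h.1.disj i j e hXi (hne j hjk hjz ▸ hj)
    · rcases key l hl with rfl | rfl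
      · exact fun g _ => (val_mono Set.sdiff_subset).trans (hYk_le i hi)
      · exact fun g _ => (val_mono Set.sdiff_subset).trans (hzfree i hi).1
    · rcases key l hl with rfl | rfl
      · exact fun _ _ _ => val_mono fun e he => (hcov i hi he.1).resolve_right he.2
      · exact fun _ _ _ => (hzfree i hi).2.1
    · rcases key l hl with rfl | rfl
      · exact fun _ _ _ _ _ _ => hcov i hi
      · exact fun e he heb _ _ _ => (hzfree i hi).2.2 e he heb
    · rcases key l hl with rfl | rfl
      · exact absurd hlF hk
      · exact hzfree
    · rcases key l hl with rfl | rfl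
      · intro _ _ _
        rw [btw_comm, Set.union_comm]
        exact hcov y hyl
      · exact fun e _ heb => absurd heb (hF _ hz y hy e)
  exact h.not_lt hst hle k (by rwa [hYk])

/-- If the goods join `F` to its complement, the unallocated goods at a vertex `k` outside `F` can
be given to `k`, or to a vertex in `F` which envies it. -/
theorem IsOptimal.hasEFX_of_bipartite [Finite E] (h : P.IsOptimal F X)
    (hF : ∀ z ∈ F, ∀ z' ∈ F, ∀ e, e ∉ P.btw z z')
    (hF' : ∀ k, k ∉ F → ∀ k', k' ∉ F → ∀ e, e ∉ P.btw k k') : P.HasEFX := by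
  have hd : ∀ k, ∃ d, k ∉ F → (d = k ∧ ∀ z ∈ F, P.val z (X k) ≤ P.val z (X z)) ∨
      (d ∈ F ∧ P.val d (X d) < P.val d (X k)) := by
    intro k
    by_cases hex : ∃ z ∈ F, P.val z (X z) < P.val z (X k)
    · obtain ⟨z, hz, hlt⟩ := hex
      exact ⟨z, fun _ => Or.inr ⟨hz, hlt⟩⟩
    · push Not at hex
      exact ⟨k, fun _ => Or.inl ⟨rfl, hex⟩⟩
  choose d hd using hd
  have huniq : ∀ e k k', k ∉ F → k' ∉ F → e ∈ P.inc k → e ∈ P.inc k' → k = k' := by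
    intro e k k' hk hk' he he'
    by_contra hne
    exact hF' k hk k' hk' e (mem_btw_of_ne he he' hne)
  have hex : ∀ e, ∃ k ∉ F, e ∈ P.inc k := by
    intro e
    by_contra! hcon
    refine hF (P.src e) ?_ (P.tgt e) ?_ e (Or.inl ⟨rfl, rfl⟩)
    · by_contra hs; exact hcon _ hs (Or.inl rfl)
    · by_contra ht; exact hcon _ ht (Or.inr rfl)
  refine ⟨fun i => X i ∪ {e | (∀ k, e ∉ X k) ∧ ∃ k ∉ F, e ∈ P.inc k ∧ d k = i}, ?_, fun e => ?_,
    fun i j g hg => ?_⟩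
  · rintro i j e (hi | ⟨hi, k, hk, hek, rfl⟩) (hj | ⟨hj, l, hl, hel, rfl⟩)
    · exact h.1.disj i j e hi hj
    · exact absurd hi (hj i)
    · exact absurd hj (hi j)
    · rw [huniq e k l hk hl hek hel]
  · by_cases he : ∃ k, e ∈ X k
    · exact he.imp fun k hk => Or.inl hk
    · push Not at he
      obtain ⟨k, hk, hek⟩ := hex e
      exact ⟨d k, Or.inr ⟨he, k, hk, hek, rfl⟩⟩
  · by_cases hij : i = j
    · subst hij; exact val_mono Set.sdiff_subset
    refine le_trans ?_ (val_mono Set.subset_union_left)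
    by_cases hj : j ∈ F
    · refine (val_mono Set.sdiff_subset).trans ?_
      by_cases hi : i ∈ F
      · refine le_trans (val_le ?_) (h.val_rest_le i)
        rintro e (he | he) hei
        · exact absurd (mem_btw_of_ne hei (h.1.inc j e he) hij) (hF i hi j hj e)
        · exact ⟨hei, he.1⟩
      by_cases hdi : d i = j
      · subst hdi
        have hlt : P.val (d i) (X (d i)) < P.val (d i) (X i) :=
          (hd i hi).elim (fun h => absurd h.1.symm hij) fun h => h.2
        refine le_trans (val_le ?_) (h.val_le_of_envy hF hj hi hlt)
        rintro e (he | he) hei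
        · exact Or.inr ⟨mem_btw_of_ne hei (h.1.inc _ e he) hij,
            fun he' => hij (h.1.disj _ _ e he' he)⟩
        · exact Or.inl ⟨hei, he.1⟩
      · refine le_trans (val_le ?_) (h.1.free j hj i)
        rintro e (he | ⟨_, k, hk, hek, hdk⟩) hei
        · exact he
        · exact absurd (huniq e k i hk hi hek hei ▸ hdk) hdi
    · have hsub : X j ∪ {e | (∀ k, e ∉ X k) ∧ ∃ k ∉ F, e ∈ P.inc k ∧ d k = j} ⊆
          X j ∪ P.rest X j := by
        rintro e (he | ⟨he, k, hk, hek, hdk⟩)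
        · exact Or.inl he
        · refine Or.inr ⟨?_, he⟩
          rcases hd k hk with hd | hd
          · rwa [← hdk, hd.1]
          · exact absurd (hdk ▸ hd.1) hj
      rcases hd j hj with hdj | hdj
      · refine (val_mono (Set.sdiff_subset.trans hsub)).trans ?_
        by_cases hi : i ∈ F
        -- If `j` holds a good shared with `i`, their pair has no leftover by `full` and `i` sees
        -- only `X j`; otherwise `i` sees only leftovers.
        · by_cases hX : ∃ f ∈ X j, f ∈ P.btw j i
          · obtain ⟨f, hf, hfb⟩ := hX
            refine le_trans (val_le ?_) (hdj.2 i hi)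
            rintro e (he | he) hei
            · exact he
            · exact ((h.1.full i hi j f hf hfb (mem_btw_of_ne he.1 hei (Ne.symm hij))).elim
                (he.2 j) (he.2 i)).elim
          · push Not at hX
            refine le_trans (val_le ?_) (h.val_rest_le i)
            rintro e (he | he) hei
            · exact absurd (mem_btw_of_ne (h.1.inc j e he) hei (Ne.symm hij)) (hX e he)
            · exact ⟨hei, he.2⟩
        · refine val_le_of_not_inc _ fun e he hei => hF' i hi j hj e (mem_btw_of_ne hei ?_ hij)
          exact he.elim (h.1.inc j e) fun he => he.1
      · have hXj : X j ∪ {e | (∀ k, e ∉ X k) ∧ ∃ k ∉ F, e ∈ P.inc k ∧ d k = j} = X j := by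
          refine Set.union_eq_left.2 ?_
          rintro e ⟨he, k, hk, hek, hdk⟩
          rcases hd k hk with hd' | hd'
          · have : k = j := hd'.1.symm.trans hdk
            subst this
            exact absurd (hdk ▸ hdj.1) hj
          · exact absurd (hdk ▸ hd'.1) hj
        beta_reduce at hg ⊢
        rw [hXj] at hg ⊢
        exact h.1.efx i j g hg

end Market

/-! ### Graphs without short cycles. -/

section Walks

variable {I : Type*} {H : SimpleGraph I}

/-- A graph without cycles of length three or four is bipartite or has a path of length four. -/
theorem colorable_two_or_exists_path (h3 : ∀ a b c, H.Adj a b → H.Adj b c → H.Adj c a → False)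
    (h4 : ∀ a b c d, a ≠ c → b ≠ d → H.Adj a b → H.Adj b c → H.Adj c d → H.Adj d a → False) :
    H.Colorable 2 ∨ ∃ x : Fin 5 → I, x.Injective ∧ ∀ i : Fin 4, H.Adj (x i.castSucc) (x i.succ) := by
  by_cases hac : H.IsAcyclic
  · exact Or.inl hac.colorable_two
  refine Or.inr ?_
  unfold SimpleGraph.IsAcyclic at hac
  push Not at hac
  obtain ⟨v, w, hw⟩ := hac
  have hadj : ∀ i, i < w.length → H.Adj (w.getVert i) (w.getVert (i + 1)) :=
    fun i hi => w.adj_getVert_succ hi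
  have hinj := hw.getVert_injOn'
  have h0 : w.getVert w.length = w.getVert 0 := by simp
  have hlen : 5 ≤ w.length := by
    have := hw.three_le_length
    by_contra hlt
    obtain hl | hl : w.length = 3 ∨ w.length = 4 := by omega
    · refine h3 _ _ _ (hadj 0 (by omega)) (hadj 1 (by omega)) ?_
      rw [← h0, hl]; exact hadj 2 (by omega)
    · refine h4 _ _ _ _ ?_ ?_ (hadj 0 (by omega)) (hadj 1 (by omega)) (hadj 2 (by omega)) ?_
      · intro h; have := hinj (by simp) (by simp; omega) h; omega
      · intro h; have := hinj (by simp; omega) (by simp; omega) h; omega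
      · rw [← h0, hl]; exact hadj 3 (by omega)
  refine ⟨fun i => w.getVert i, fun i j h => ?_, fun i => ?_⟩
  · have := hinj (by have := i.2; simp; omega) (by have := j.2; simp; omega) h
    exact Fin.ext this
  · exact hadj i (by have := i.2; omega)

/-- Three vertices of a path such that each edge has ends that are not adjacent to one of them. -/
theorem exists_not_adj
    (h4 : ∀ a b c d, a ≠ c → b ≠ d → H.Adj a b → H.Adj b c → H.Adj c d → H.Adj d a → False)
    (h5 : ∀ a b c d e, H.Adj a b → H.Adj b c → H.Adj c d → H.Adj d e → H.Adj e a → False)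
    {x : Fin 5 → I} (hx : x.Injective) (hadj : ∀ i : Fin 4, H.Adj (x i.castSucc) (x i.succ))
    {s t : I} (hst : H.Adj s t) :
    ∃ z ∈ ({x 0, x 2, x 4} : Set I), ¬ H.Adj s z ∧ ¬ H.Adj t z := by
  have h01 : H.Adj (x 0) (x 1) := hadj 0
  have h12 : H.Adj (x 1) (x 2) := hadj 1
  have h23 : H.Adj (x 2) (x 3) := hadj 2
  have h34 : H.Adj (x 3) (x 4) := hadj 3
  -- Without 4-cycles, `x 1` is the only common neighbour of `x 0` and `x 2`, and `x 3` that of `x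
  -- 2` and `x 4`.
  have all : ∀ s, H.Adj s (x 0) → H.Adj s (x 2) → H.Adj s (x 4) → False := by
    intro s h0 h2 h4'
    have hs1 : s = x 1 := by
      by_contra hne
      exact h4 s (x 0) (x 1) (x 2) hne (hx.ne (by decide)) h0 h01 h12 h2.symm
    have hs3 : s = x 3 := by
      by_contra hne
      exact h4 s (x 2) (x 3) (x 4) hne (hx.ne (by decide)) h2 h23 h34 h4'.symm
    exact absurd (hx (hs1.symm.trans hs3)) (by decide)
  -- If `s` and `t` are adjacent to different ends of a two-edge segment of the path, they close it
  -- to a walk of length five.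
  have two : ∀ s t, H.Adj s t → (H.Adj s (x 0) → H.Adj s (x 2) → H.Adj t (x 4) → False) ∧
      (H.Adj s (x 0) → H.Adj t (x 2) → H.Adj s (x 4) → False) ∧
      (H.Adj t (x 0) → H.Adj s (x 2) → H.Adj s (x 4) → False) := by
    intro s t hst
    exact ⟨fun _ b c => h5 s _ _ _ t b h23 h34 c.symm hst.symm,
      fun a b _ => h5 s _ _ _ t a h01 h12 b.symm hst.symm,
      fun a b _ => h5 s _ _ _ t b h12.symm h01.symm a.symm hst.symm⟩
  by_contra! hcon
  have hc : ∀ z ∈ ({x 0, x 2, x 4} : Set I), H.Adj s z ∨ H.Adj t z := fun z hz =>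
    or_iff_not_imp_left.2 (hcon z hz)
  obtain ⟨s1, s2, s3⟩ := two s t hst
  obtain ⟨t1, t2, t3⟩ := two t s hst.symm
  rcases hc (x 0) (by simp) with p | p <;> rcases hc (x 2) (by simp) with q | q <;>
    rcases hc (x 4) (by simp) with r | r
  exacts [all s p q r, s1 p q r, s2 p q r, t3 p q r, s3 p q r, t2 p q r, t1 p q r, all t p q r]

end Walks

/-! ### The theorem for markets. -/

namespace Market

variable {I E : Type*}

/-- The vertices of a market, two of which are adjacent if there is a good between them. -/
def graph (P : Market I E) : SimpleGraph I where
  Adj i j := ∃ e, e ∈ P.btw i j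
  symm := ⟨fun i j ⟨e, he⟩ => ⟨e, by rwa [btw_comm]⟩⟩
  loopless := ⟨fun _ ⟨_, he⟩ => notMem_btw_self he⟩

theorem hasEFX_of_colorable_two [Finite I] [Finite E] {P : Market I E}
    (hP : P.graph.Colorable 2) : P.HasEFX := by
  obtain ⟨C⟩ := hP
  have hF : ∀ z ∈ {i | C i = 0}, ∀ z' ∈ {i | C i = 0}, ∀ e, e ∉ P.btw z z' :=
    fun z hz z' hz' e he => C.valid ⟨e, he⟩ (Eq.trans hz (Eq.symm hz'))
  obtain ⟨X, hX⟩ := P.exists_isState hF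
  obtain ⟨Y, hY⟩ := hX.exists_isOptimal
  refine hY.hasEFX_of_bipartite hF fun k hk k' hk' e he => C.valid ⟨e, he⟩ ?_
  have hk : C k ≠ 0 := hk
  have hk' : C k' ≠ 0 := hk'
  omega

/-- A market without cycles of length three, four or five has a complete allocation that is
envy-free up to any good. -/
theorem hasEFX [Finite I] [Finite E] {P : Market I E}
    (h3 : ∀ a b c, P.graph.Adj a b → P.graph.Adj b c → P.graph.Adj c a → False)
    (h4 : ∀ a b c d, a ≠ c → b ≠ d → P.graph.Adj a b → P.graph.Adj b c → P.graph.Adj c d →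
      P.graph.Adj d a → False)
    (h5 : ∀ a b c d e, a ≠ c → a ≠ d → b ≠ d → b ≠ e → c ≠ e → P.graph.Adj a b →
      P.graph.Adj b c → P.graph.Adj c d → P.graph.Adj d e → P.graph.Adj e a → False) :
    P.HasEFX := by
  -- A closed walk of length five with a repeated vertex contains a triangle.
  have h5' : ∀ a b c d e, P.graph.Adj a b → P.graph.Adj b c → P.graph.Adj c d →
      P.graph.Adj d e → P.graph.Adj e a → False := by
    intro a b c d e hab hbc hcd hde hea
    refine h5 a b c d e ?_ ?_ ?_ ?_ ?_ hab hbc hcd hde hea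
    · rintro rfl; exact h3 _ _ _ hcd hde hea
    · rintro rfl; exact h3 _ _ _ hab hbc hcd
    · rintro rfl; exact h3 _ _ _ hab hde hea
    · rintro rfl; exact h3 _ _ _ hbc hcd hde
    · rintro rfl; exact h3 _ _ _ hab hbc hea
  obtain hcol | ⟨x, hx, hadj⟩ := colorable_two_or_exists_path h3 h4
  · exact hasEFX_of_colorable_two hcol
  have hF : ∀ z ∈ ({x 0, x 2, x 4} : Set I), ∀ z' ∈ ({x 0, x 2, x 4} : Set I), ∀ e,
      e ∉ P.btw z z' := by
    have h02 : ¬ P.graph.Adj (x 0) (x 2) := fun h => h3 _ _ _ (hadj 0) (hadj 1) h.symm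
    have h24 : ¬ P.graph.Adj (x 2) (x 4) := fun h => h3 _ _ _ (hadj 2) (hadj 3) h.symm
    have h04 : ¬ P.graph.Adj (x 0) (x 4) := fun h =>
      h5' _ _ _ _ _ (hadj 0) (hadj 1) (hadj 2) (hadj 3) h.symm
    intro z hz z' hz' e he
    have hzz : P.graph.Adj z z' := ⟨e, he⟩
    rcases hz with rfl | rfl | rfl <;> rcases hz' with rfl | rfl | rfl
    exacts [hzz.ne rfl, h02 hzz, h04 hzz, h02 hzz.symm, hzz.ne rfl, h24 hzz, h04 hzz.symm,
      h24 hzz.symm, hzz.ne rfl]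
  obtain ⟨X, hX⟩ := P.exists_isState hF
  obtain ⟨Y, hY⟩ := hX.exists_isOptimal
  choose τ hτF hτ using fun e : E => exists_not_adj h4 h5' hx hadj
    (s := P.src e) (t := P.tgt e) ⟨e, Or.inl ⟨rfl, rfl⟩⟩
  refine hY.hasEFX_of_dump τ hτF fun e i hei f hf => ?_
  rcases hei with rfl | rfl
  · exact (hτ e).1 ⟨f, hf⟩
  · exact (hτ e).2 ⟨f, hf⟩

end Market

/-! ### From multigraphs to markets. -/

variable {V E : Type*} {G : Graph V E}

/-- A cycle of length at least three contains no parallel edges. -/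
theorem isNonparallelCycle_of_three_le {k : ℕ} {x : ℕ → V} {e : ℕ → E} (hk : 3 ≤ k)
    (hx : x k = x 0) (hne : ∀ s t, s < t → t < k → x s ≠ x t)
    (hlink : ∀ t, t < k → G.IsLink (e t) (x t) (x (t + 1))) : IsNonparallelCycle G k x e := by
  have hinj : ∀ s t, s < k → t < k → x s = x t → s = t := by
    intro s t hs ht h
    by_contra hst
    rcases Nat.lt_or_gt_of_ne hst with hlt | hlt
    · exact hne s t hlt ht h
    · exact hne t s hlt hs h.symm
  refine ⟨by omega, hx, hinj, hlink, ?_⟩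
  rintro s t hs ht hst ⟨a, b, ha, hb⟩
  have hl := (hlink t ht).eq_and_eq_or_eq_and_eq hb
  have hl' := (hlink s hs).eq_and_eq_or_eq_and_eq ha
  have hcase : x s = x t ∨ x s = x (t + 1) ∧ x (s + 1) = x t := by grind
  have hsucc : ∀ i j, i < k → j < k → x i = x (j + 1) → i = j + 1 ∨ i = 0 ∧ j + 1 = k := by
    intro i j hi hj h
    rcases Nat.lt_or_ge (j + 1) k with hlt | hge
    · exact Or.inl (hinj _ _ hi hlt h)
    · have : j + 1 = k := by omega
      rw [this, hx] at h
      exact Or.inr ⟨hinj _ _ hi (by omega) h, this⟩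
  rcases hcase with h | ⟨h1, h2⟩
  · exact hst (hinj _ _ hs ht h)
  -- Parallel edges run in opposite directions would make each of `s`, `t` the cyclic successor of
  -- the other, forcing `k ≤ 2`.
  · have := hsucc s t hs ht h1
    have := hsucc t s ht hs h2.symm
    omega

theorem IsValuation.union_eq {i : V} {v : Set E → ℝ} (hv : IsValuation G i v) {S D : Set E}
    (hS : S ⊆ E(G)) (hD : D.Finite) (hDE : D ⊆ E(G)) (hinc : ∀ e ∈ D, ¬ G.Inc e i) :
    v (S ∪ D) = v S := by
  induction D, hD using Set.Finite.induction_on with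
  | empty => rw [Set.union_empty]
  | @insert a D _ _ ih =>
    rw [Set.insert_subset_iff] at hDE
    rw [Set.union_insert, ← Set.union_singleton,
      hv.irrelevant _ a (Set.union_subset hS hDE.2) hDE.1 (hinc a (Set.mem_insert _ _))]
    exact ih hDE.2 fun e he => hinc e (Set.mem_insert_of_mem _ he)

/-- Adding `S \ T` to `T` does not change the value, since none of its edges is at `i`, and the
union contains `S`. -/
theorem IsValuation.le_of_inc {i : V} {v : Set E → ℝ} (hv : IsValuation G i v)
    (hE : E(G).Finite) {S T : Set E} (hS : S ⊆ E(G)) (hT : T ⊆ E(G))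
    (h : ∀ e ∈ S, G.Inc e i → e ∈ T) : v S ≤ v T := by
  have hD : S \ T ⊆ E(G) := Set.sdiff_subset.trans hS
  rw [← hv.union_eq hT (hE.subset hD) hD fun e he hi => he.2 (h e he.1 hi)]
  refine hv.mono _ _ (fun e he => ?_) (Set.union_subset hT hD)
  by_cases heT : e ∈ T
  · exact Or.inl heT
  · exact Or.inr ⟨he, heT⟩

end MultigraphEFX

theorem theorem3 {V E : Type*} (G : Graph V E)
    (hV : V(G).Finite) (hE : E(G).Finite)
    (hG : ∀ (k : ℕ) (x : ℕ → V) (e : ℕ → E), MultigraphEFX.IsNonparallelCycle G k x e → 6 ≤ k)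
    (v : V → Set E → ℝ) (hv : ∀ i ∈ V(G), MultigraphEFX.IsValuation G i (v i)) :
    ∃ X : V → Set E, MultigraphEFX.IsCompleteAllocation G X ∧ MultigraphEFX.IsEFX G v X := by
  classical
  have := hV.to_subtype
  have := hE.to_subtype
  have hends : ∀ e : E(G), ∃ s t : V(G), G.IsLink e s t := by
    rintro ⟨e, he⟩
    obtain ⟨s, t, h⟩ := Graph.exists_isLink_of_mem_edgeSet he
    exact ⟨⟨s, h.left_mem⟩, ⟨t, h.right_mem⟩, h⟩
  choose src tgt hlink using hends
  have hincG : ∀ (e : E(G)) (i : V(G)), G.Inc e i → src e = i ∨ tgt e = i := by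
    rintro e i ⟨y, hy⟩
    have := (hlink e).eq_and_eq_or_eq_and_eq hy
    exact this.imp (fun h => Subtype.ext h.1) fun h => Subtype.ext h.2
  have hne : ∀ e, src e ≠ tgt e := by
    intro e heq
    have hl := hlink e
    rw [← heq] at hl
    -- A loop would be a cycle of length one.
    have := hG 1 (fun _ => src e) (fun _ => e) ⟨by omega, rfl, by omega, fun _ _ => hl, by omega⟩
    omega
  have himage : ∀ S : Set E(G), Subtype.val '' S ⊆ E(G) := by
    rintro S _ ⟨e, -, rfl⟩; exact e.2
  let P : MultigraphEFX.Market V(G) E(G) :=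
    { src := src
      tgt := tgt
      src_ne_tgt := hne
      val := fun i S => v i (Subtype.val '' S)
      val_empty := fun i => by rw [Set.image_empty]; exact (hv i i.2).empty
      val_le_of_inc := by
        intro i S T h
        refine (hv i i.2).le_of_inc hE (himage S) (himage T) ?_
        rintro _ ⟨e, he, rfl⟩ hinc
        exact ⟨e, h e he (hincG e i hinc), rfl⟩ }
  have hadj : ∀ i j : V(G), P.graph.Adj i j → ∃ e, G.IsLink e i j := by
    rintro i j ⟨e, ⟨rfl, rfl⟩ | ⟨rfl, rfl⟩⟩
    · exact ⟨e, hlink e⟩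
    · exact ⟨e, (hlink e).symm⟩
  have hval {i j : V(G)} (h : i ≠ j) : (i : V) ≠ j := Subtype.val_injective.ne h
  have hP : P.HasEFX := by
    refine MultigraphEFX.Market.hasEFX ?_ ?_ ?_
    · intro a b c hab hbc hca
      have := hval hab.ne; have := hval hbc.ne; have := hval hca.ne.symm
      obtain ⟨e₀, h₀⟩ := hadj _ _ hab
      obtain ⟨e₁, h₁⟩ := hadj _ _ hbc
      obtain ⟨e₂, h₂⟩ := hadj _ _ hca
      -- The default value `a` closes the cycle at index `3`; the longer cycles below are closed in
      -- the same way.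
      have := hG 3 (fun n => match n with | 0 => a | 1 => b | 2 => c | _ => a)
        (fun n => match n with | 0 => e₀ | 1 => e₁ | _ => e₂)
        (MultigraphEFX.isNonparallelCycle_of_three_le (by omega) rfl
          (by intro s t hs ht; interval_cases t <;> interval_cases s <;> assumption)
          (by intro t ht; interval_cases t <;> assumption))
      omega
    · intro a b c d hac hbd hab hbc hcd hda
      have := hval hab.ne; have := hval hbc.ne; have := hval hcd.ne; have := hval hda.ne.symm
      have := hval hac; have := hval hbd
      obtain ⟨e₀, h₀⟩ := hadj _ _ hab
      obtain ⟨e₁, h₁⟩ := hadj _ _ hbc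
      obtain ⟨e₂, h₂⟩ := hadj _ _ hcd
      obtain ⟨e₃, h₃⟩ := hadj _ _ hda
      have := hG 4 (fun n => match n with | 0 => a | 1 => b | 2 => c | 3 => d | _ => a)
        (fun n => match n with | 0 => e₀ | 1 => e₁ | 2 => e₂ | _ => e₃)
        (MultigraphEFX.isNonparallelCycle_of_three_le (by omega) rfl
          (by intro s t hs ht; interval_cases t <;> interval_cases s <;> assumption)
          (by intro t ht; interval_cases t <;> assumption))
      omega
    · intro a b c d e hac had hbd hbe hce hab hbc hcd hde hea
      have := hval hab.ne; have := hval hbc.ne; have := hval hcd.ne; have := hval hde.ne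
      have := hval hea.ne.symm; have := hval hac; have := hval had; have := hval hbd
      have := hval hbe; have := hval hce
      obtain ⟨e₀, h₀⟩ := hadj _ _ hab
      obtain ⟨e₁, h₁⟩ := hadj _ _ hbc
      obtain ⟨e₂, h₂⟩ := hadj _ _ hcd
      obtain ⟨e₃, h₃⟩ := hadj _ _ hde
      obtain ⟨e₄, h₄⟩ := hadj _ _ hea
      have := hG 5 (fun n => match n with | 0 => a | 1 => b | 2 => c | 3 => d | 4 => e | _ => a)
        (fun n => match n with | 0 => e₀ | 1 => e₁ | 2 => e₂ | 3 => e₃ | _ => e₄)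
        (MultigraphEFX.isNonparallelCycle_of_three_le (by omega) rfl
          (by intro s t hs ht; interval_cases t <;> interval_cases s <;> assumption)
          (by intro t ht; interval_cases t <;> assumption))
      omega
  obtain ⟨Z, hdisj, hcompl, hefx⟩ := hP
  refine ⟨fun i => if hi : i ∈ V(G) then Subtype.val '' Z ⟨i, hi⟩ else ∅, ⟨⟨?_, ?_⟩, ?_⟩, ?_⟩
  · intro i hi
    rw [dif_pos hi]
    exact himage _
  · intro i hi j hj hij
    rw [dif_pos hi, dif_pos hj, Set.disjoint_left]
    rintro _ ⟨e, he, rfl⟩ ⟨f, hf, hef⟩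
    rw [Subtype.ext hef] at hf
    exact hij (congrArg Subtype.val (hdisj _ _ e he hf))
  · intro e he
    obtain ⟨i, hi⟩ := hcompl ⟨e, he⟩
    refine ⟨i, i.2, ?_⟩
    rw [dif_pos i.2]
    exact ⟨_, hi, rfl⟩
  · intro i hi j hj g hg
    simp only [dif_pos hi, dif_pos hj] at hg ⊢
    obtain ⟨g, hgZ, rfl⟩ := hg
    have := hefx ⟨i, hi⟩ ⟨j, hj⟩ g hgZ
    rwa [← Set.image_singleton, ← Set.image_sdiff Subtype.val_injective]
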